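/- Let $G$ be a compact Lie group acting continuously on a compactly generated Hausdorff space $X$. Assume that there is a subgroup $H \le G$ such that the stabilizer of every point of $X$ is conjugate to $H$. Then the quotient map $q : X \to X/G$ is a Serre fibration, i.e. it is continuous and has the homotopy lifting property with respect to the cubes $[0,1]^n$ for all $n \ge 0$. -/

import Mathlib

open scoped Manifold ContDiff unitInterval

/-- A map `p : E → B` has the homotopy lifting property with respect to a space `A` if every
homotopy `h : A × I → B` together with a lift `f : A → E` of its start `h (·, 0)` admits a
continuous lift `A × I → E` starting at `f`. -/
def HasHomotopyLifting (A : Type*) [TopologicalSpace A] {E B : Type*} [TopologicalSpace E]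
    [TopologicalSpace B] (p : E → B) : Prop :=
  ∀ (f : C(A, E)) (h : C(A × I, B)), (∀ a, h (a, 0) = p (f a)) →
    ∃ k : C(A × I, E), (∀ a, k (a, 0) = f a) ∧ ∀ z, p (k z) = h z

/-- A Serre fibration: a continuous map that has the homotopy lifting property with respect to
all cubes `I ^ n`, `n ≥ 0`. -/
def IsSerreFibration {E B : Type*} [TopologicalSpace E] [TopologicalSpace B] (p : E → B) : Prop :=
  Continuous p ∧ ∀ n : ℕ, HasHomotopyLifting (Fin n → I) p

/-!
After pulling back along a homotopy `h` and an appeal to compactness, everything happens on a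
compact Hausdorff space `Y` with one orbit type, and the point is to find *slices*: closed sets
that meet each orbit near a given orbit exactly once. A slice is a local section of the quotient
map, with constant stabilizer.

*Slices.* Let `x₀` have stabilizer `H`. Averaging over `H` a smooth nonnegative function with zero
set `H` gives a right `H`-invariant function `u` on `G` that vanishes exactly on `H`
(`exists_invariant_function`). Extend `g • x₀ ↦ u g` to `ψ : Y → ℝ` by Tietze's theorem, and let
`φ x ∈ L²(G)` be the function `g ↦ ψ (g⁻¹ • x)`. Then `φ` is equivariant for the left translations,
which are isometries, the stabilizer of `φ x₀` is exactly `H`, and the orbit of `φ x₀` is twice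
differentiable. Such an orbit has positive reach (`orbit_positive_reach`): a vector close to the
orbit has only one nearest point on it. Hence the points `x` near `x₀` at which `‖φ x - φ x₀‖` is
least on the orbit of `x` are permuted by `H` only. Their stabilizers lie in `H` and are conjugate
to `H`, so they equal `H` because `G` is compact, and each orbit contains just one such point
(`exists_slice_function`, `exists_isOpen_liftsOn`).

*Positive reach.* No structure theory of closed subgroups is used. If `D` is the derivative of the
orbit map at `1` and `D ξ = 0`, then the powers `c (n⁻¹ • ξ) ^ n`, with `c` a chart at `1`, move
`φ x₀` by `O(1 / n)`, so they accumulate at an element of `H` close to `c ξ`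
(`exists_mem_stabilizer_near`). Therefore a point of the orbit near `φ x₀` is reached by some `c m`
with `‖m‖` bounded by a multiple of the distance (`exists_param_norm_le`), and positive reach
follows from the second order Taylor estimate of the orbit map at `1`.

*Homotopy lifting.* Two lifts with constant stabilizer `H` over boxes with a common face differ
there by elements of `G`, which are determined up to `H`; extended along the projection to the
face, they serve to glue the lifts (`continuousOn_smul_of_eq_smul`, `LiftsOn.union_of_retract`).
So `h` has a lift `κ` over the whole cube with stabilizer `H`, and if `f a = g a • κ (a, 0)` is the
prescribed start, then `(a, t) ↦ g a • κ (a, t)` is the required lift.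
-/

open Set Filter Topology MeasureTheory

/-! ### Stabilizers in compact groups -/

/-- A closed subgroup of a compact group is not conjugate to a proper subgroup of itself, because
`g⁻¹` is a limit of positive powers of `g`. -/
theorem Subgroup.map_conj_eq_of_le {G : Type*} [Group G] [TopologicalSpace G]
    [IsTopologicalGroup G] [CompactSpace G] {H : Subgroup G} (hH : IsClosed (H : Set G)) {g : G}
    (h : H.map (MulAut.conj g).toMonoidHom ≤ H) : H.map (MulAut.conj g).toMonoidHom = H := by
  refine le_antisymm h fun x hx ↦ ?_
  have hpow : ∀ n : ℕ, g ^ n * x * (g ^ n)⁻¹ ∈ H := by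
    intro n
    induction n with
    | zero => simpa using hx
    | succ n ih =>
      have : g * (g ^ n * x * (g ^ n)⁻¹) * g⁻¹ ∈ H := h ⟨_, ih, by simp⟩
      simpa [pow_succ', mul_assoc] using this
  have hcl : IsClosed {k : G | k * x * k⁻¹ ∈ H} :=
    hH.preimage (f := fun k : G ↦ k * x * k⁻¹) (by fun_prop)
  have hmem : g⁻¹ ∈ _root_.closure (range (g ^ · : ℕ → G)) :=
    by
    rw [mem_closure_iff_clusterPt]
    exact (mapClusterPt_inv_atTop_pow.2 (mapClusterPt_self_atTop_pow g)).clusterPt.mono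
      (le_principal_iff.2 range_mem_map)
  have : g⁻¹ * x * g⁻¹⁻¹ ∈ H :=
    closure_minimal (t := {k : G | k * x * k⁻¹ ∈ H}) (range_subset_iff.2 hpow) hcl hmem
  exact ⟨_, this, by simp [mul_assoc]⟩

section

variable {G : Type*} [Group G] [TopologicalSpace G] [CompactSpace G]
  {X : Type*} [TopologicalSpace X] [T2Space X] [MulAction G X] [ContinuousSMul G X]

theorem isClosed_stabilizer {G : Type*} [Group G] [TopologicalSpace G] {X : Type*}
    [TopologicalSpace X] [T2Space X] [MulAction G X] [ContinuousSMul G X] (x : X) :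
    IsClosed (MulAction.stabilizer G x : Set G) :=
  isClosed_eq (f := fun g : G ↦ g • x) (by fun_prop) continuous_const

/-- If all stabilizers are conjugate, then nested stabilizers agree. -/
theorem stabilizer_eq_of_le [IsTopologicalGroup G] {H : Subgroup G}
    (hH : ∀ x : X, ∃ g : G, MulAction.stabilizer G x = H.map (MulAut.conj g).toMonoidHom)
    {x y : X} (hxy : MulAction.stabilizer G x ≤ MulAction.stabilizer G y) :
    MulAction.stabilizer G x = MulAction.stabilizer G y := by
  obtain ⟨g, hg⟩ := hH x
  obtain ⟨k, hk⟩ := hH y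
  have key : MulAction.stabilizer G x =
      (MulAction.stabilizer G y).map (MulAut.conj (g * k⁻¹)).toMonoidHom := by
    rw [hg, hk, Subgroup.map_map]
    congr 1
    ext z
    simp [mul_assoc]
  rw [key] at hxy ⊢
  exact Subgroup.map_conj_eq_of_le (isClosed_stabilizer y) hxy

/-! ### Lifts with constant stabilizer -/

/-- Transport along the action: if `β = n • α` with `α`, `β` continuous, then `n • γ` is continuous
for every continuous `γ` whose stabilizers contain those of `α`. The function `n` itself need not
be continuous, being determined only up to the stabilizer of `α`. -/
theorem continuousOn_smul_of_eq_smul {G : Type*} [Group G] [TopologicalSpace G] [CompactSpace G]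
    {X : Type*} [TopologicalSpace X] [T2Space X] [MulAction G X] [ContinuousSMul G X]
    {Z : Type*} [TopologicalSpace Z] {s : Set Z} {α β γ : Z → X}
    {n : Z → G} (hα : ContinuousOn α s) (hβ : ContinuousOn β s) (hγ : ContinuousOn γ s)
    (hn : ∀ z ∈ s, β z = n z • α z)
    (hst : ∀ z ∈ s, MulAction.stabilizer G (α z) ≤ MulAction.stabilizer G (γ z)) :
    ContinuousOn (fun z ↦ n z • γ z) s := by
  intro z hz
  refine (tendsto_iff_ultrafilter _ _ _).2 fun 𝒰 h𝒰 ↦ ?_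
  -- along an ultrafilter the values of `n` converge by compactness of `G`
  set m : G := (𝒰.map n).lim
  have hm : Tendsto n 𝒰 (𝓝 m) := (𝒰.map n).le_nhds_lim
  have h1 : Tendsto (fun z ↦ n z • α z) 𝒰 (𝓝 (m • α z)) := hm.smul ((hα z hz).mono_left h𝒰)
  have hs : ∀ᶠ w in (𝒰 : Filter Z), w ∈ s := h𝒰 self_mem_nhdsWithin
  have h2 : Tendsto (fun z ↦ n z • α z) 𝒰 (𝓝 (β z)) :=
    ((hβ z hz).mono_left h𝒰).congr' (hs.mono fun w hw ↦ hn w hw)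
  have h3 : m • α z = n z • α z := (tendsto_nhds_unique h1 h2).trans (hn z hz)
  have h4 : (n z)⁻¹ * m ∈ MulAction.stabilizer G (α z) := by
    rw [MulAction.mem_stabilizer_iff, mul_smul, h3, inv_smul_smul]
  have h5 : m • γ z = n z • γ z := by
    have := hst z hz h4
    rwa [MulAction.mem_stabilizer_iff, mul_smul, inv_smul_eq_iff] at this
  change Tendsto _ _ (𝓝 (n z • γ z))
  rw [← h5]
  exact hm.smul ((hγ z hz).mono_left h𝒰)

/-- The map `h` into the orbit space has, over the set `s`, a continuous lift all of whose values
have stabilizer exactly `H`. -/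
def LiftsOn {G : Type*} [Group G] {X : Type*} [TopologicalSpace X] [MulAction G X]
    {Z : Type*} [TopologicalSpace Z] (H : Subgroup G)
    (h : Z → Quotient (MulAction.orbitRel G X)) (s : Set Z) : Prop :=
  ∃ κ : Z → X, ContinuousOn κ s ∧
    ∀ z ∈ s, Quotient.mk (MulAction.orbitRel G X) (κ z) = h z ∧ MulAction.stabilizer G (κ z) = H

theorem exists_smul_eq_of_mk_eq {G X : Type*} [Group G] [MulAction G X] {x y : X}
    (h : Quotient.mk (MulAction.orbitRel G X) x = Quotient.mk (MulAction.orbitRel G X) y) :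
    ∃ g : G, x = g • y := by
  obtain ⟨g, hg⟩ := MulAction.orbitRel_apply.1 (Quotient.exact h)
  exact ⟨g, hg.symm⟩

theorem LiftsOn.mono {G : Type*} [Group G] {X : Type*} [TopologicalSpace X] [MulAction G X]
    {Z : Type*} [TopologicalSpace Z] {H : Subgroup G}
    {h : Z → Quotient (MulAction.orbitRel G X)} {s t : Set Z} (hs : LiftsOn H h s) (hts : t ⊆ s) :
    LiftsOn H h t := by
  obtain ⟨κ, hκ, hκ'⟩ := hs
  exact ⟨κ, hκ.mono hts, fun z hz ↦ hκ' z (hts hz)⟩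

/-- Two lifts over closed sets can be glued if one of the sets retracts onto the intersection:
the element of `G` moving one lift to the other is extended along the retraction. -/
theorem LiftsOn.union_of_retract {Z : Type*} [TopologicalSpace Z] {H : Subgroup G}
    {h : Z → Quotient (MulAction.orbitRel G X)} {s t : Set Z} (hs : LiftsOn H h s)
    (ht : LiftsOn H h t) (hsc : IsClosed s) (htc : IsClosed t) {r : Z → Z}
    (hr : ContinuousOn r t) (hrm : MapsTo r t (s ∩ t)) (hri : ∀ z ∈ s ∩ t, r z = z) :
    LiftsOn H h (s ∪ t) := by
  classical
  obtain ⟨κ, hκ, hκ'⟩ := hs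
  obtain ⟨τ, hτ, hτ'⟩ := ht
  have hex : ∀ z ∈ t, ∃ g : G, κ (r z) = g • τ (r z) := fun z hz ↦
    exists_smul_eq_of_mk_eq
      ((hκ' _ (hrm hz).1).1.trans (hτ' _ (hrm hz).2).1.symm)
  choose! n hn using hex
  have hcont : ContinuousOn (fun z ↦ n z • τ z) t :=
    continuousOn_smul_of_eq_smul (α := fun z ↦ τ (r z)) (β := fun z ↦ κ (r z))
      (hτ.comp hr fun z hz ↦ (hrm hz).2) (hκ.comp hr fun z hz ↦ (hrm hz).1) hτ hn
      fun z hz ↦ by rw [(hτ' _ (hrm hz).2).2, (hτ' _ hz).2]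
  have heq : ∀ z ∈ s ∩ t, κ z = n z • τ z := fun z hz ↦ by
    have := hn z hz.2
    rwa [hri z hz] at this
  have hst : ∀ z ∈ t, MulAction.stabilizer G (n z • τ z) = H := fun z hz ↦ by
    have h1 := (hκ' _ (hrm hz).1).2
    rw [hn z hz, MulAction.stabilizer_smul_eq_stabilizer_map_conj, (hτ' _ (hrm hz).2).2] at h1
    rw [MulAction.stabilizer_smul_eq_stabilizer_map_conj, (hτ' _ hz).2, h1]
  refine ⟨fun z ↦ if z ∈ s then κ z else n z • τ z, ?_, ?_⟩
  · refine ContinuousOn.union_of_isClosed (hκ.congr fun z hz ↦ if_pos hz)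
      (hcont.congr fun z hz ↦ ?_) hsc htc
    by_cases hzs : z ∈ s
    · simpa [hzs] using heq z ⟨hzs, hz⟩
    · simp [hzs]
  · intro z hz
    by_cases hzs : z ∈ s
    · simpa [hzs] using hκ' z hzs
    · have hzt := hz.resolve_left hzs
      simp only [hzs, if_false]
      refine ⟨?_, hst z hzt⟩
      rw [← (hτ' z hzt).1]
      exact Quotient.sound (MulAction.orbitRel_apply.2 ⟨n z, rfl⟩)

/-! ### From small boxes to all boxes -/

/-- A property of boxes that is inherited by a box from the two parts into which a hyperplane
cuts it, and that holds for small boxes, holds for all boxes. -/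
theorem box_induction {ι : Type*} [Fintype ι] [DecidableEq ι] {P : (ι → ℝ) → (ι → ℝ) → Prop}
    (hglue : ∀ a b i m, a i ≤ m → m ≤ b i → P a (Function.update b i m) →
      P (Function.update a i m) b → P a b)
    {ε : ℝ} (hε : 0 < ε) (hsmall : ∀ a b, (∀ i, b i - a i ≤ ε) → P a b) (a b : ι → ℝ) :
    P a b := by
  have key : ∀ s : Finset ι, ∀ a b : ι → ℝ, (∀ i ∉ s, b i - a i ≤ ε) → P a b := by
    intro s
    induction s using Finset.induction_on with
    | empty => exact fun a b h ↦ hsmall a b fun i ↦ h i (by simp)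
    | insert j s hj ih =>
      have aux : ∀ n : ℕ, ∀ a b : ι → ℝ, (∀ i ∉ insert j s, b i - a i ≤ ε) →
          b j - a j ≤ n * ε → P a b := by
        intro n
        induction n with
        | zero =>
          intro a b h h0
          refine ih a b fun i hi ↦ ?_
          by_cases hij : i = j
          · subst hij; norm_num at h0; linarith
          · exact h i (by simp [hij, hi])
        | succ n ihn =>
          intro a b h hn
          rcases le_total (b j - a j) ε with hle | hle
          · refine ih a b fun i hi ↦ ?_
            by_cases hij : i = j
            · subst hij; exact hle
            · exact h i (by simp [hij, hi])
          · refine hglue a b j (a j + ε) (by linarith) (by linarith) (ih _ _ fun i hi ↦ ?_)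
              (ihn _ _ (fun i hi ↦ ?_) ?_)
            · by_cases hij : i = j
              · subst hij; simp
              · simpa [Function.update_of_ne hij] using h i (by simp [hij, hi])
            · have hij : i ≠ j := fun h ↦ hi (by simp [h])
              simpa [Function.update_of_ne hij] using h i hi
            · push_cast at hn
              simp only [Function.update_self]
              linarith
      intro a b h
      obtain ⟨n, hn⟩ := exists_nat_ge ((b j - a j) / ε)
      exact aux n a b h ((div_le_iff₀ hε).1 hn)
  exact key Finset.univ a b (by simp)

/-- A map from a box into the orbit space that lifts locally, with values of stabilizer `H`,
lifts globally. -/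
theorem liftsOn_Icc_of_locally {ι : Type*} [Fintype ι] {H : Subgroup G}
    {h : (ι → ℝ) → Quotient (MulAction.orbitRel G X)} {a b : ι → ℝ}
    (hloc : ∀ z ∈ Icc a b, ∃ U : Set (ι → ℝ), IsOpen U ∧ z ∈ U ∧ LiftsOn H h (U ∩ Icc a b)) :
    LiftsOn H h (Icc a b) := by
  classical
  choose! U hUo hzU hU using hloc
  obtain ⟨δ, hδ, hball⟩ := lebesgue_number_lemma_of_metric (isCompact_Icc (a := a) (b := b))
    (c := fun z : Icc a b ↦ U z) (fun z ↦ hUo z z.2)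
    (fun z hz ↦ mem_iUnion.2 ⟨⟨z, hz⟩, hzU z hz⟩)
  refine box_induction (P := fun c d ↦ Icc c d ⊆ Icc a b → LiftsOn H h (Icc c d)) ?_
    (half_pos hδ) ?_ a b Subset.rfl
  · intro c d i m hc hd h1 h2 hsub
    have hs : Icc c (Function.update d i m) ⊆ Icc c d :=
      Icc_subset_Icc_right (update_le_iff.2 ⟨hd, fun _ _ ↦ le_rfl⟩)
    have ht : Icc (Function.update c i m) d ⊆ Icc c d :=
      Icc_subset_Icc_left (le_update_iff.2 ⟨hc, fun _ _ ↦ le_rfl⟩)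
    refine ((h1 (hs.trans hsub)).union_of_retract (h2 (ht.trans hsub)) isClosed_Icc isClosed_Icc
      (r := fun z ↦ Function.update z i m) (by fun_prop) ?_ ?_).mono ?_
    · intro z hz
      have hz' := ht hz
      refine ⟨⟨le_update_iff.2 ⟨hc, fun j _ ↦ hz'.1 j⟩,
        update_le_update_iff.2 ⟨le_rfl, fun j _ ↦ hz'.2 j⟩⟩,
        update_le_update_iff.2 ⟨le_rfl, fun j _ ↦ hz'.1 j⟩,
        update_le_iff.2 ⟨hd, fun j _ ↦ hz'.2 j⟩⟩
    · rintro z ⟨hz1, hz2⟩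
      have e1 : z i ≤ m := by simpa using hz1.2 i
      have e2 : m ≤ z i := by simpa using hz2.1 i
      rw [Function.update_eq_self_iff]
      exact le_antisymm e2 e1
    · intro z hz
      rcases le_total (z i) m with hzm | hzm
      · exact Or.inl ⟨hz.1, le_update_iff.2 ⟨hzm, fun j _ ↦ hz.2 j⟩⟩
      · exact Or.inr ⟨update_le_iff.2 ⟨hzm, fun j _ ↦ hz.1 j⟩, hz.2⟩
  · intro c d hcd hsub
    rcases (Icc c d).eq_empty_or_nonempty with he | ⟨z, hz⟩
    · rw [he]
      -- any function lifts over the empty set; if `X` is empty, so is the domain of `h`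
      by_cases hX : Nonempty X
      · exact ⟨fun _ ↦ hX.some, continuousOn_empty _, by simp⟩
      · exact ⟨fun z ↦ (hX ⟨(h z).out⟩).elim, continuousOn_empty _, by simp⟩
    · have hc : c ∈ Icc c d := ⟨le_rfl, hz.1.trans hz.2⟩
      obtain ⟨w, hw⟩ := hball c (hsub hc)
      refine (hU w w.2).mono fun y hy ↦ ⟨hw ?_, hsub hy⟩
      rw [Metric.mem_ball]
      refine lt_of_le_of_lt ((dist_pi_le_iff (half_pos hδ).le).2 fun i ↦ ?_) (half_lt_self hδ)
      rw [Real.dist_eq, abs_of_nonneg (sub_nonneg.2 (hy.1 i))]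
      linarith [hcd i, hy.2 i]

end

/-! ### Local parametrization of a Lie group at the identity -/

/-- Maps `c : V → G` and `ℓ : G → V` that parametrize the group `G` near `1` by a neighbourhood
of `0`, and in which multiplication and division are strictly differentiable at the origin. -/
structure IsLocalParam {V : Type*} [NormedAddCommGroup V] [NormedSpace ℝ V]
    {G : Type*} [Group G] [TopologicalSpace G] (c : V → G) (ℓ : G → V) : Prop where
  map_zero : c 0 = 1
  map_one : ℓ 1 = 0
  left_inv : ∀ᶠ m in 𝓝 (0 : V), ℓ (c m) = m
  right_inv : ∀ᶠ g in 𝓝 (1 : G), c (ℓ g) = g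
  continuousAt : ∀ᶠ m in 𝓝 (0 : V), ContinuousAt c m
  continuousAt_symm : ContinuousAt ℓ 1
  mul : HasStrictFDerivAt (fun p : V × V ↦ ℓ (c p.1 * c p.2))
    (ContinuousLinearMap.fst ℝ V V + ContinuousLinearMap.snd ℝ V V) 0
  mul_inv : HasStrictFDerivAt (fun p : V × V ↦ ℓ (c p.1 * (c p.2)⁻¹))
    (ContinuousLinearMap.fst ℝ V V - ContinuousLinearMap.snd ℝ V V) 0

section

variable (V : Type*) [NormedAddCommGroup V] [NormedSpace ℝ V]
  (G : Type*) [Group G] [TopologicalSpace G] [ChartedSpace V G]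

/-- The inverse of the preferred chart at `1`, recentred so that `0` is sent to `1`. -/
noncomputable def oneParam (m : V) : G :=
  (extChartAt 𝓘(ℝ, V) (1 : G)).symm (extChartAt 𝓘(ℝ, V) (1 : G) 1 + m)

/-- The preferred chart at `1`, recentred so that `1` is sent to `0`. -/
noncomputable def oneChart (g : G) : V :=
  extChartAt 𝓘(ℝ, V) (1 : G) g - extChartAt 𝓘(ℝ, V) (1 : G) 1

variable {V G}

theorem oneParam_zero : oneParam V G 0 = 1 := by
  simp [oneParam]

theorem eventually_add_mem_target :
    ∀ᶠ m in 𝓝 (0 : V), extChartAt 𝓘(ℝ, V) (1 : G) 1 + m ∈ (extChartAt 𝓘(ℝ, V) (1 : G)).target := by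
  have h : Tendsto (fun m : V ↦ extChartAt 𝓘(ℝ, V) (1 : G) 1 + m) (𝓝 0)
      (𝓝 (extChartAt 𝓘(ℝ, V) (1 : G) 1)) := by
    have : Continuous (fun m : V ↦ extChartAt 𝓘(ℝ, V) (1 : G) 1 + m) := by fun_prop
    simpa using this.tendsto 0
  exact h (extChartAt_target_mem_nhds (1 : G))

theorem eventually_oneChart_oneParam : ∀ᶠ m in 𝓝 (0 : V), oneChart V G (oneParam V G m) = m := by
  filter_upwards [eventually_add_mem_target (V := V) (G := G)] with m hm
  rw [oneChart, oneParam, PartialEquiv.right_inv _ hm]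
  abel

theorem eventually_oneParam_oneChart : ∀ᶠ g in 𝓝 (1 : G), oneParam V G (oneChart V G g) = g := by
  have h : (extChartAt 𝓘(ℝ, V) (1 : G)).source ∈ 𝓝 (1 : G) := extChartAt_source_mem_nhds 1
  filter_upwards [h] with g hg
  rw [oneChart, oneParam, add_sub_cancel, PartialEquiv.left_inv _ hg]

theorem contMDiffAt_oneChart_one [IsManifold 𝓘(ℝ, V) ∞ G] :
    ContMDiffAt 𝓘(ℝ, V) 𝓘(ℝ, V) ∞ (oneChart V G) 1 :=
  contMDiffAt_extChartAt.sub contMDiffAt_const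

variable [LieGroup 𝓘(ℝ, V) ∞ G]

theorem eventually_contMDiffAt_oneParam :
    ∀ᶠ m in 𝓝 (0 : V), ContMDiffAt 𝓘(ℝ, V) 𝓘(ℝ, V) ∞ (oneParam V G) m := by
  filter_upwards [eventually_add_mem_target (V := V) (G := G)] with m hm
  have h : ContMDiffAt 𝓘(ℝ, V) 𝓘(ℝ, V) ∞ (extChartAt 𝓘(ℝ, V) (1 : G)).symm
      (extChartAt 𝓘(ℝ, V) (1 : G) 1 + m) :=
    (contMDiffOn_extChartAt_symm (1 : G)).contMDiffAt
      ((isOpen_extChartAt_target (1 : G)).mem_nhds hm)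
  exact h.comp m (f := fun m ↦ extChartAt 𝓘(ℝ, V) (1 : G) 1 + m)
    (contDiff_const.add contDiff_id).contMDiff.contMDiffAt

theorem contMDiffAt_oneParam_zero : ContMDiffAt 𝓘(ℝ, V) 𝓘(ℝ, V) ∞ (oneParam V G) 0 :=
  eventually_contMDiffAt_oneParam.self_of_nhds

theorem isLocalParam_oneParam : IsLocalParam (oneParam V G) (oneChart V G) where
  map_zero := oneParam_zero
  map_one := sub_self _
  left_inv := eventually_oneChart_oneParam
  right_inv := eventually_oneParam_oneChart
  continuousAt := eventually_contMDiffAt_oneParam.mono fun _ h ↦ h.continuousAt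
  continuousAt_symm := contMDiffAt_oneChart_one.continuousAt
  mul := by
    have hf : ContDiffAt ℝ ∞ (fun p : V × V ↦
        oneChart V G (oneParam V G p.1 * oneParam V G p.2)) 0 := by
      rw [← contMDiffAt_iff_contDiffAt]
      have h1 : ContMDiffAt 𝓘(ℝ, V × V) 𝓘(ℝ, V) ∞ (fun p : V × V ↦ oneParam V G p.1) 0 :=
        ContMDiffAt.comp (0 : V × V) contMDiffAt_oneParam_zero
          (f := Prod.fst) contDiff_fst.contMDiff.contMDiffAt
      have h2 : ContMDiffAt 𝓘(ℝ, V × V) 𝓘(ℝ, V) ∞ (fun p : V × V ↦ oneParam V G p.2) 0 :=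
        ContMDiffAt.comp (0 : V × V) contMDiffAt_oneParam_zero
          (f := Prod.snd) contDiff_snd.contMDiff.contMDiffAt
      refine ContMDiffAt.comp (0 : V × V) (g := oneChart V G) ?_ (h1.mul h2)
      simpa [oneParam_zero] using contMDiffAt_oneChart_one
    have hd := hf.hasStrictFDerivAt (by simp)
    refine hd.congr_fderiv ?_
    -- the derivative is determined by the restrictions to the two axes
    have h1 := HasFDerivAt.comp (0 : V) (f := fun m : V ↦ (m, (0 : V))) hd.hasFDerivAt
      (hasFDerivAt_prodMk_left (𝕜 := ℝ) (0 : V) (0 : V))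
    have h2 := HasFDerivAt.comp (0 : V) (f := fun m : V ↦ ((0 : V), m)) hd.hasFDerivAt
      (hasFDerivAt_prodMk_right (𝕜 := ℝ) (0 : V) (0 : V))
    have h1' := h1.congr_of_eventuallyEq (f₁ := id)
      ((eventually_oneChart_oneParam (G := G)).mono fun m hm ↦ by simp [oneParam_zero, hm])
    have h2' := h2.congr_of_eventuallyEq (f₁ := id)
      ((eventually_oneChart_oneParam (G := G)).mono fun m hm ↦ by simp [oneParam_zero, hm])
    have e1 := h1'.unique (hasFDerivAt_id 0)
    have e2 := h2'.unique (hasFDerivAt_id 0)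
    refine ContinuousLinearMap.ext fun p ↦ ?_
    have e1' := DFunLike.congr_fun e1 p.1
    have e2' := DFunLike.congr_fun e2 p.2
    simp only [ContinuousLinearMap.comp_apply, ContinuousLinearMap.inl_apply,
      ContinuousLinearMap.inr_apply, ContinuousLinearMap.id_apply] at e1' e2'
    have hp : p = (p.1, 0) + (0, p.2) := by simp
    conv_lhs => rw [hp, map_add, e1', e2']
    rfl
  mul_inv := by
    have hf : ContDiffAt ℝ ∞ (fun p : V × V ↦
        oneChart V G (oneParam V G p.1 * (oneParam V G p.2)⁻¹)) 0 := by
      rw [← contMDiffAt_iff_contDiffAt]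
      have h1 : ContMDiffAt 𝓘(ℝ, V × V) 𝓘(ℝ, V) ∞ (fun p : V × V ↦ oneParam V G p.1) 0 :=
        ContMDiffAt.comp (0 : V × V) contMDiffAt_oneParam_zero
          (f := Prod.fst) contDiff_fst.contMDiff.contMDiffAt
      have h2 : ContMDiffAt 𝓘(ℝ, V × V) 𝓘(ℝ, V) ∞ (fun p : V × V ↦ oneParam V G p.2) 0 :=
        ContMDiffAt.comp (0 : V × V) contMDiffAt_oneParam_zero
          (f := Prod.snd) contDiff_snd.contMDiff.contMDiffAt
      refine ContMDiffAt.comp (0 : V × V) (g := oneChart V G) ?_ (h1.mul h2.inv)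
      simpa [oneParam_zero] using contMDiffAt_oneChart_one
    have hd := hf.hasStrictFDerivAt (by simp)
    refine hd.congr_fderiv ?_
    -- the derivative is determined by the restrictions to the first axis and to the diagonal
    have h1 := HasFDerivAt.comp (0 : V) (f := fun m : V ↦ (m, (0 : V))) hd.hasFDerivAt
      (hasFDerivAt_prodMk_left (𝕜 := ℝ) (0 : V) (0 : V))
    have h2 := HasFDerivAt.comp (0 : V) (f := fun m : V ↦ (m, m)) hd.hasFDerivAt
      ((hasFDerivAt_id (𝕜 := ℝ) (0 : V)).prodMk
      (hasFDerivAt_id (𝕜 := ℝ) (0 : V)))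
    have h1' := h1.congr_of_eventuallyEq (f₁ := id)
      ((eventually_oneChart_oneParam (G := G)).mono fun m hm ↦ by simp [oneParam_zero, hm])
    have h2' := h2.congr_of_eventuallyEq (f₁ := fun _ ↦ 0)
      (.of_forall fun m ↦ by simp [oneChart])
    have e1 := h1'.unique (hasFDerivAt_id 0)
    have e2 := h2'.unique (hasFDerivAt_const 0 0)
    refine ContinuousLinearMap.ext fun p ↦ ?_
    have e1' := DFunLike.congr_fun e1 (p.1 - p.2)
    have e2' := DFunLike.congr_fun e2 p.2
    simp only [ContinuousLinearMap.comp_apply, ContinuousLinearMap.inl_apply,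
      ContinuousLinearMap.id_apply, ContinuousLinearMap.prod_apply,
      zero_apply] at e1' e2'
    have hp : p = (p.1 - p.2, 0) + (p.2, p.2) := by simp
    conv_lhs => rw [hp, map_add, e1']
    erw [e2']
    simp

end

/-! ### A uniform second order Taylor estimate -/

/-- Second order Taylor estimate in one variable, locally uniform in the other. -/
theorem ContDiffAt.exists_taylor_bound {E V : Type*} [NormedAddCommGroup E] [NormedSpace ℝ E]
    [NormedAddCommGroup V] [NormedSpace ℝ V] {f : E × V → ℝ} {p₀ : E}
    (hf : ContDiffAt ℝ 2 f (p₀, 0)) :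
    ∃ C ε : ℝ, 0 < ε ∧ ∀ᶠ p in 𝓝 p₀, ∃ L : V →ₗ[ℝ] ℝ, ∀ m, ‖m‖ < ε →
      |f (p, m) - f (p, 0) - L m| ≤ C * ‖m‖ ^ 2 := by
  have h1 : ContDiffAt ℝ 1 (fderiv ℝ f) (p₀, 0) := hf.fderiv_right (by norm_num)
  obtain ⟨K, t, ht, hK⟩ := h1.exists_lipschitzOnWith
  have hdiff : ∀ᶠ q in 𝓝 (p₀, (0 : V)), DifferentiableAt ℝ f q :=
    (hf.eventually (by norm_num)).mono fun q hq ↦ hq.differentiableAt (by norm_num)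
  obtain ⟨u, hu, v, hv, huv⟩ := mem_nhds_prod_iff.1 (inter_mem ht hdiff)
  obtain ⟨ε, hε, hball⟩ := Metric.mem_nhds_iff.1 hv
  refine ⟨K, ε, hε, ?_⟩
  filter_upwards [hu] with p hp
  refine ⟨(fderiv ℝ f (p, 0) ∘L ContinuousLinearMap.inr ℝ E V).toLinearMap, fun m hm ↦ ?_⟩
  have hmem : ∀ x ∈ Metric.closedBall (0 : V) ‖m‖, (p, x) ∈ t ∧ DifferentiableAt ℝ f (p, x) :=
    fun x hx ↦ huv ⟨hp, hball (by simp at hx ⊢; linarith)⟩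
  have hder : ∀ x ∈ Metric.closedBall (0 : V) ‖m‖, HasFDerivWithinAt (fun x ↦ f (p, x))
      (fderiv ℝ f (p, x) ∘L ContinuousLinearMap.inr ℝ E V) (Metric.closedBall (0 : V) ‖m‖) x :=
    fun x hx ↦ ((hmem x hx).2.hasFDerivAt.comp x
      (hasFDerivAt_prodMk_right (𝕜 := ℝ) p x)).hasFDerivWithinAt
  have := (convex_closedBall (0 : V) ‖m‖).norm_image_sub_le_of_norm_hasFDerivWithin_le'
    (φ := fderiv ℝ f (p, 0) ∘L ContinuousLinearMap.inr ℝ E V) (C := K * ‖m‖) hder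
    (fun x hx ↦ ?_) (x := 0) (y := m) (by simp) (by simp)
  · simpa [mul_assoc, pow_two] using this
  · rw [← ContinuousLinearMap.sub_comp]
    refine (ContinuousLinearMap.opNorm_comp_le _ _).trans ?_
    have h2 : ‖fderiv ℝ f (p, x) - fderiv ℝ f (p, 0)‖ ≤ K * ‖m‖ := by
      refine (hK.norm_sub_le (hmem x hx).1 (hmem 0 (by simp)).1).trans ?_
      gcongr
      simpa [Prod.norm_def] using hx
    calc _ ≤ (K * ‖m‖) * 1 := by
          gcongr
          exact ContinuousLinearMap.norm_inr_le_one ℝ E V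
      _ = _ := mul_one _

/-! ### Nearest points on orbits of isometric actions -/

section

variable {G : Type*} [Group G] {W : Type*} [NormedAddCommGroup W] {O : G → W}

theorem orbit_mul_inv_eq (hiso : ∀ k g g', ‖O (k * g) - O (k * g')‖ = ‖O g - O g'‖) {h : G}
    (hh : O h = O 1) (g : G) : O (g * h⁻¹) = O g := by
  have h1 := hiso (g * h⁻¹) 1 h
  rw [hh, sub_self, norm_zero, norm_eq_zero, sub_eq_zero] at h1
  simpa using h1

theorem norm_orbit_pow_sub_le (hiso : ∀ k g g', ‖O (k * g) - O (k * g')‖ = ‖O g - O g'‖) (g : G)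
    (n : ℕ) : ‖O (g ^ n) - O 1‖ ≤ n * ‖O g - O 1‖ := by
  induction n with
  | zero => simp
  | succ n ih =>
    have h1 := hiso (g ^ n) g 1
    rw [← pow_succ, mul_one] at h1
    calc ‖O (g ^ (n + 1)) - O 1‖ ≤ ‖O (g ^ (n + 1)) - O (g ^ n)‖ + ‖O (g ^ n) - O 1‖ :=
          norm_sub_le_norm_sub_add_norm_sub _ _ _
      _ ≤ ‖O g - O 1‖ + n * ‖O g - O 1‖ := by rw [h1]; gcongr
      _ = _ := by push_cast; ring

variable [TopologicalSpace G] {V : Type*} [NormedAddCommGroup V] [NormedSpace ℝ V]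
  {c : V → G} {ℓ : G → V}

theorem IsLocalParam.exists_mul_bound (hc : IsLocalParam c ℓ) [ContinuousMul G] {δ : ℝ}
    (hδ : 0 < δ) : ∃ ρ > 0, ∀ a b : V, ‖a‖ < ρ → ‖b‖ < ρ →
      c (ℓ (c a * c b)) = c a * c b ∧ ‖ℓ (c a * c b) - a - b‖ ≤ δ * ‖b‖ := by
  have hc0 : ContinuousAt c 0 := hc.continuousAt.self_of_nhds
  have h1 : ContinuousAt (fun p : V × V ↦ c p.1 * c p.2) (0, 0) :=
    (hc0.comp_of_eq continuousAt_fst rfl).mul (hc0.comp_of_eq continuousAt_snd rfl)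
  have h2 : ∀ᶠ p in 𝓝 ((0 : V), (0 : V)), c (ℓ (c p.1 * c p.2)) = c p.1 * c p.2 :=
    h1.eventually (by simpa [hc.map_zero] using hc.right_inv)
  have h3 : ∀ᶠ p in 𝓝 ((0 : V), (0 : V)), ℓ (c p.1) = p.1 :=
    (continuousAt_fst (p := ((0 : V), (0 : V)))).eventually hc.left_inv
  have h4 := hc.mul.isLittleO.def hδ
  rw [show (0 : V × V) = (0, 0) from rfl, nhds_prod_eq (x := ((0 : V), (0 : V)))] at h4
  obtain ⟨u, hu, v, hv, huv⟩ := mem_prod_iff.1 h4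
  obtain ⟨ρ, hρ, hball⟩ := Metric.mem_nhds_iff.1 (inter_mem (inter_mem (inter_mem hu hv) h2) h3)
  refine ⟨ρ, hρ, fun a b ha hb ↦ ?_⟩
  have hab : (a, b) ∈ Metric.ball ((0 : V), (0 : V)) ρ := by
    simp [Prod.norm_def, ha, hb, ← Prod.zero_eq_mk]
  have ha0 : (a, (0 : V)) ∈ Metric.ball ((0 : V), (0 : V)) ρ := by
    simp [Prod.norm_def, ha, ← Prod.zero_eq_mk]
  refine ⟨(hball hab).1.2, ?_⟩
  have h5 : ((a, b), (a, (0 : V))) ∈ u ×ˢ v := ⟨(hball hab).1.1.1, (hball ha0).1.1.2⟩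
  have h6 := huv h5
  have h7 : ℓ (c a) = a := (hball hab).2
  simpa [hc.map_zero, h7, Prod.norm_def] using h6

theorem IsLocalParam.exists_mul_inv_bound (hc : IsLocalParam c ℓ) [ContinuousMul G]
    [ContinuousInv G] {δ : ℝ}
    (hδ : 0 < δ) : ∃ ρ > 0, ∀ a b : V, ‖a‖ < ρ → ‖b‖ < ρ →
      c (ℓ (c a * (c b)⁻¹)) = c a * (c b)⁻¹ ∧
        ‖ℓ (c a * (c b)⁻¹) - (a - b)‖ ≤ δ * (‖a‖ + ‖b‖) := by
  have hc0 : ContinuousAt c 0 := hc.continuousAt.self_of_nhds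
  have h1 : ContinuousAt (fun p : V × V ↦ c p.1 * (c p.2)⁻¹) (0, 0) :=
    (hc0.comp_of_eq continuousAt_fst rfl).mul (hc0.comp_of_eq continuousAt_snd rfl).inv
  have h2 : ∀ᶠ p in 𝓝 ((0 : V), (0 : V)), c (ℓ (c p.1 * (c p.2)⁻¹)) = c p.1 * (c p.2)⁻¹ :=
    h1.eventually (by simpa [hc.map_zero] using hc.right_inv)
  have h4 := hc.mul_inv.hasFDerivAt.isLittleO.def hδ
  obtain ⟨ρ, hρ, hball⟩ := Metric.mem_nhds_iff.1 (inter_mem h2 h4)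
  refine ⟨ρ, hρ, fun a b ha hb ↦ ?_⟩
  have hab : (a, b) ∈ Metric.ball ((0 : V), (0 : V)) ρ := by
    simp [Prod.norm_def, ha, hb, ← Prod.zero_eq_mk]
  refine ⟨(hball hab).1, ?_⟩
  have h6 : ‖ℓ (c a * (c b)⁻¹) - (a - b)‖ ≤ δ * ‖(a, b)‖ := by
    simpa [hc.map_zero, hc.map_one] using (hball hab).2
  refine h6.trans ?_
  gcongr
  simp [Prod.norm_def]

variable [NormedSpace ℝ W] {D : V →ₗ[ℝ] W} {C : ℝ}

/-- Directions in which the orbit map has vanishing derivative are tangent to the stabilizer: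
the stabilizer contains a limit of the powers `c (n⁻¹ • ξ) ^ n`. -/
theorem exists_mem_stabilizer_near [FiniteDimensional ℝ V] [ContinuousMul G]
    (hc : IsLocalParam c ℓ) (hO : Continuous O)
    (hiso : ∀ k g g', ‖O (k * g) - O (k * g')‖ = ‖O g - O g'‖)
    (hD : ∀ᶠ m in 𝓝 0, ‖O (c m) - O 1 - D m‖ ≤ C * ‖m‖ ^ 2) {δ : ℝ} (hδ : 0 < δ) (hδ1 : δ ≤ 1) :
    ∀ᶠ ξ in 𝓝 0, D ξ = 0 → ∃ a, ‖a - ξ‖ ≤ δ * ‖ξ‖ ∧ O (c a) = O 1 := by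
  obtain ⟨ρ, hρ, hmul⟩ := hc.exists_mul_bound hδ
  obtain ⟨r, hr, hball⟩ := Metric.mem_nhds_iff.1 (inter_mem hD hc.continuousAt)
  set s := min ρ r with hs
  have hs0 : 0 < s := lt_min hρ hr
  filter_upwards [Metric.ball_mem_nhds (0 : V) (half_pos hs0)] with ξ hξ hDξ
  rw [mem_ball_zero_iff] at hξ
  have step : ∀ n : ℕ, 0 < n → ∃ a, ‖a - ξ‖ ≤ δ * ‖ξ‖ ∧ ‖O (c a) - O 1‖ ≤ C * ‖ξ‖ ^ 2 / n := by
    intro n hn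
    have hn' : (0 : ℝ) < n := by exact_mod_cast hn
    set b : V := (n : ℝ)⁻¹ • ξ with hb
    have hbn : ‖b‖ = ‖ξ‖ / n := by
      rw [hb, norm_smul, norm_inv, Real.norm_natCast]; ring
    have hnb : ‖ξ‖ = n * ‖b‖ := by rw [hbn]; field_simp
    have hbs : ‖b‖ < s := by
      have : ‖b‖ ≤ ‖ξ‖ := by
        rw [hbn]; exact div_le_self (norm_nonneg _) (by exact_mod_cast hn)
      linarith
    have hpow : ∀ k : ℕ, k ≤ n → ∃ a, ‖a - (k : ℝ) • b‖ ≤ δ * (k * ‖b‖) ∧ c a = c b ^ k := by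
      intro k
      induction k with
      | zero => exact fun _ ↦ ⟨0, by simp, by simp [hc.map_zero]⟩
      | succ k ih =>
        intro hk
        obtain ⟨a, ha, hca⟩ := ih (by lia)
        have hkn : (k : ℝ) * ‖b‖ ≤ ‖ξ‖ := by
          rw [hnb]; gcongr; lia
        have has : ‖a‖ < s := by
          have h1 : ‖a‖ ≤ ‖a - (k : ℝ) • b‖ + ‖(k : ℝ) • b‖ := by
            simpa using norm_add_le (a - (k : ℝ) • b) ((k : ℝ) • b)
          rw [norm_smul, Real.norm_natCast] at h1
          have h2 : δ * (k * ‖b‖) ≤ 1 * (k * ‖b‖) := by gcongr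
          linarith
        obtain ⟨h1, h2⟩ := hmul a b (has.trans_le (min_le_left _ _))
          (hbs.trans_le (min_le_left _ _))
        refine ⟨ℓ (c a * c b), ?_, by rw [h1, hca, pow_succ]⟩
        calc ‖ℓ (c a * c b) - ((k + 1 : ℕ) : ℝ) • b‖
            = ‖(ℓ (c a * c b) - a - b) + (a - (k : ℝ) • b)‖ := by
              congr 1; push_cast; rw [add_smul, one_smul]; abel
          _ ≤ δ * ‖b‖ + δ * (k * ‖b‖) := (norm_add_le _ _).trans (add_le_add h2 ha)
          _ = _ := by push_cast; ring
    obtain ⟨a, ha, hca⟩ := hpow n le_rfl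
    have hnξ : (n : ℝ) • b = ξ := by rw [hb, smul_smul, mul_inv_cancel₀ hn'.ne', one_smul]
    rw [hnξ, ← hnb] at ha
    refine ⟨a, ha, ?_⟩
    have hT : ‖O (c b) - O 1 - D b‖ ≤ C * ‖b‖ ^ 2 :=
      (hball (mem_ball_zero_iff.2 (hbs.trans_le (min_le_right _ _)))).1
    rw [hb, map_smul, hDξ, smul_zero, sub_zero, ← hb] at hT
    rw [hca]
    calc _ ≤ n * ‖O (c b) - O 1‖ := norm_orbit_pow_sub_le hiso _ _
      _ ≤ n * (C * ‖b‖ ^ 2) := by gcongr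
      _ = _ := by rw [hbn]; field_simp
  choose a ha ha' using fun n : ℕ ↦ step (n + 1) n.succ_pos
  obtain ⟨x, hx, φ, hφ, hlim⟩ := (isCompact_closedBall ξ (δ * ‖ξ‖)).tendsto_subseq
    (x := a) fun n ↦ mem_closedBall_iff_norm.2 (ha n)
  have hx' : ‖x - ξ‖ ≤ δ * ‖ξ‖ := mem_closedBall_iff_norm.1 hx
  refine ⟨x, hx', ?_⟩
  have hxr : ‖x‖ < r := by
    have h1 : ‖x‖ ≤ ‖x - ξ‖ + ‖ξ‖ := by simpa using norm_add_le (x - ξ) ξ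
    have h2 : δ * ‖ξ‖ ≤ 1 * ‖ξ‖ := by gcongr
    linarith [min_le_right ρ r]
  have hcx : ContinuousAt c x := (hball (mem_ball_zero_iff.2 hxr)).2
  have h1 : Tendsto (fun n ↦ ‖O (c (a (φ n))) - O 1‖) atTop (𝓝 ‖O (c x) - O 1‖) :=
    (((hO.continuousAt.comp hcx).tendsto.comp hlim).sub_const _).norm
  have h2 : Tendsto (fun n ↦ ‖O (c (a n)) - O 1‖) atTop (𝓝 0) := by
    refine squeeze_zero (fun _ ↦ norm_nonneg _) (fun n ↦ ha' n) ?_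
    have := (tendsto_const_div_atTop_nhds_zero_nat (C * ‖ξ‖ ^ 2)).comp (tendsto_add_atTop_nat 1)
    exact this
  have h3 := tendsto_nhds_unique h1 (h2.comp hφ.tendsto_atTop)
  rwa [norm_eq_zero, sub_eq_zero] at h3

theorem LinearMap.exists_ker_approx {V W : Type*} [NormedAddCommGroup V] [NormedSpace ℝ V]
    [FiniteDimensional ℝ V] [NormedAddCommGroup W] [NormedSpace ℝ W] (D : V →ₗ[ℝ] W) :
    ∃ M > 0, ∀ m, ∃ ξ, D ξ = 0 ∧ ‖m - ξ‖ ≤ M * ‖D m‖ := by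
  obtain ⟨R, hR⟩ := D.rangeRestrict.exists_rightInverse_of_surjective D.range_rangeRestrict
  obtain ⟨M, hM, hbound⟩ := (LinearMap.toContinuousLinearMap R).bound
  refine ⟨M, hM, fun m ↦ ⟨m - R (D.rangeRestrict m), ?_, ?_⟩⟩
  · have := DFunLike.congr_fun hR (D.rangeRestrict m)
    have h2 : D (R (D.rangeRestrict m)) = D m := congrArg Subtype.val this
    rw [map_sub, h2, sub_self]
  · simpa using hbound (D.rangeRestrict m)

/-- A point of the orbit close to `O 1` has the form `O (c m)` with `‖m‖` bounded by a multiple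
of its distance to `O 1`. The parameter `m` of least norm does it: it is almost transversal to the
stabilizer. -/
theorem exists_param_norm_le [FiniteDimensional ℝ V] [IsTopologicalGroup G]
    (hc : IsLocalParam c ℓ) (hO : Continuous O)
    (hiso : ∀ k g g', ‖O (k * g) - O (k * g')‖ = ‖O g - O g'‖)
    (hD : ∀ᶠ m in 𝓝 0, ‖O (c m) - O 1 - D m‖ ≤ C * ‖m‖ ^ 2) :
    ∃ κ > 0, ∃ ρ₀ > 0, ∀ ρ, 0 < ρ → ρ < ρ₀ → ∀ g, (∃ m, ‖m‖ ≤ ρ ∧ O (c m) = O g) →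
      ∃ m, ‖m‖ ≤ ρ ∧ O (c m) = O g ∧ κ * ‖m‖ ≤ ‖O g - O 1‖ := by
  obtain ⟨M, hM, hker⟩ := D.exists_ker_approx
  obtain ⟨B, hB, hDB⟩ := (LinearMap.toContinuousLinearMap D).bound
  replace hDB : ∀ m, ‖D m‖ ≤ B * ‖m‖ := hDB
  set N := 1 + M * B with hN
  have hN1 : 1 ≤ N := by rw [hN]; nlinarith [mul_pos hM hB]
  set δ := 1 / (4 * (1 + 2 * N)) with hδ
  have hδ0 : 0 < δ := by positivity
  have hδN : δ * N + δ * (1 + 2 * N) ≤ 1 / 2 := by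
    have h1 : δ * (1 + 2 * N) = 1 / 4 := by rw [hδ]; field_simp
    nlinarith
  have hδ1 : δ ≤ 1 := by nlinarith
  obtain ⟨ρ₁, hρ₁, hmul⟩ := hc.exists_mul_inv_bound hδ0
  obtain ⟨ρ₂, hρ₂, hball⟩ := Metric.mem_nhds_iff.1 (inter_mem (inter_mem hD hc.continuousAt)
    (exists_mem_stabilizer_near hc hO hiso hD hδ0 hδ1))
  have hC : 0 < 4 * M * (|C| + 1) := by positivity
  refine ⟨1 / (4 * M), by positivity,
    min (min (ρ₁ / (2 * N)) (ρ₂ / N)) (1 / (4 * M * (|C| + 1))), by positivity, ?_⟩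
  rintro ρ hρ hρlt g ⟨m₀, hm₀, hOm₀⟩
  rw [lt_min_iff, lt_min_iff, lt_div_iff₀ (by positivity), lt_div_iff₀ (by positivity),
    lt_div_iff₀ hC] at hρlt
  obtain ⟨⟨hr1, hr2⟩, hr3⟩ := hρlt
  have hρρ₂ : ρ < ρ₂ := by nlinarith
  have hcomp : IsCompact {m : V | ‖m‖ ≤ ρ ∧ O (c m) = O g} := by
    have hcl : IsClosed (Metric.closedBall (0 : V) ρ ∩ (fun m ↦ O (c m)) ⁻¹' {O g}) := by
      refine ContinuousOn.preimage_isClosed_of_isClosed (fun m hm ↦ ?_) Metric.isClosed_closedBall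
        isClosed_singleton
      have hcm : ContinuousAt c m := (hball (mem_ball_zero_iff.2
        ((mem_closedBall_zero_iff.1 hm).trans_lt hρρ₂))).1.2
      exact (hO.continuousAt.comp hcm).continuousWithinAt
    refine (isCompact_closedBall (0 : V) ρ).of_isClosed_subset ?_ ?_ (s := {m | _})
    · convert hcl using 1
      ext m; simp
    · exact fun m hm ↦ mem_closedBall_zero_iff.2 hm.1
  obtain ⟨m, ⟨hmρ, hOm⟩, hmin⟩ := hcomp.exists_isMinOn ⟨m₀, hm₀, hOm₀⟩ continuous_norm.continuousOn
  refine ⟨m, hmρ, hOm, ?_⟩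
  obtain ⟨ξ, hDξ, hmξ⟩ := hker m
  have hξ : ‖ξ‖ ≤ N * ‖m‖ := by
    have h1 : ‖ξ‖ ≤ ‖m‖ + ‖m - ξ‖ := by
      simpa using norm_sub_le m (m - ξ)
    have h2 : M * ‖D m‖ ≤ M * (B * ‖m‖) := by gcongr; exact hDB m
    rw [hN]; linarith
  have hNm : N * ‖m‖ ≤ ρ * N := by rw [mul_comm]; gcongr
  obtain ⟨a, ha, hOa⟩ := (hball (mem_ball_zero_iff.2 (by linarith : ‖ξ‖ < ρ₂))).2 hDξ
  have haξ : ‖a - ξ‖ ≤ δ * (N * ‖m‖) := ha.trans (by gcongr)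
  have haN : ‖a‖ ≤ 2 * N * ‖m‖ := by
    have h1 : ‖a‖ ≤ ‖a - ξ‖ + ‖ξ‖ := by simpa using norm_add_le (a - ξ) ξ
    have h2 : δ * (N * ‖m‖) ≤ 1 * (N * ‖m‖) := by gcongr
    linarith
  obtain ⟨h1, h2⟩ := hmul m a (by nlinarith) (by nlinarith)
  set m' := ℓ (c m * (c a)⁻¹)
  have hOm' : O (c m') = O g := by rw [h1, orbit_mul_inv_eq hiso hOa, hOm]
  have hmm' : ‖m‖ ≤ ‖m'‖ := by
    rcases le_total ‖m'‖ ρ with h | h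
    · exact hmin ⟨h, hOm'⟩
    · exact hmρ.trans h
  have hm' : ‖m'‖ ≤ M * ‖D m‖ + ‖m‖ / 2 := by
    have e : m' = (m' - (m - a)) + (m - ξ) + (ξ - a) := by abel
    have h3 : ‖m'‖ ≤ ‖m' - (m - a)‖ + ‖m - ξ‖ + ‖ξ - a‖ := by
      conv_lhs => rw [e]
      exact norm_add₃_le
    rw [norm_sub_rev ξ a] at h3
    have h4 : δ * (‖m‖ + ‖a‖) ≤ δ * (‖m‖ + 2 * N * ‖m‖) := by gcongr
    have h5 := mul_le_mul_of_nonneg_right hδN (norm_nonneg m)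
    linarith
  have hDm : ‖m‖ ≤ 2 * M * ‖D m‖ := by linarith
  have hT : ‖O (c m) - O 1 - D m‖ ≤ C * ‖m‖ ^ 2 :=
    (hball (mem_ball_zero_iff.2 (hmρ.trans_lt hρρ₂))).1.1
  rw [hOm] at hT
  have hlow : ‖D m‖ - C * ‖m‖ ^ 2 ≤ ‖O g - O 1‖ := by
    have := norm_sub_norm_le (D m) (O g - O 1)
    rw [norm_sub_rev (D m)] at this
    linarith
  have hCm : C * ‖m‖ ^ 2 * (4 * M) ≤ ‖m‖ := by
    have h3 : C ≤ |C| + 1 := by linarith [le_abs_self C]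
    calc C * ‖m‖ ^ 2 * (4 * M) ≤ (|C| + 1) * ‖m‖ ^ 2 * (4 * M) := by gcongr
      _ = (‖m‖ * (4 * M * (|C| + 1))) * ‖m‖ := by ring
      _ ≤ (ρ * (4 * M * (|C| + 1))) * ‖m‖ := by gcongr
      _ ≤ 1 * ‖m‖ := by gcongr
      _ = ‖m‖ := one_mul _
  rw [one_div_mul_eq_div, div_le_iff₀ (by positivity)]
  nlinarith [mul_le_mul_of_nonneg_right hlow (by positivity : 0 ≤ 4 * M)]

end

/-- The orbit of an isometric action on a Euclidean space, through a vector along which the action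
is twice differentiable, has positive reach: among points of the orbit, two nearest points to a
vector that is close to the orbit agree. Indeed `P - O 1` is orthogonal to the tangent space of the
orbit, so the inner product of `P - O 1` and `O g - O 1` is of second order in `O g - O 1`. -/
theorem orbit_positive_reach {V : Type*} [NormedAddCommGroup V] [NormedSpace ℝ V]
    [FiniteDimensional ℝ V] {G : Type*} [Group G] [TopologicalSpace G] [IsTopologicalGroup G]
    [CompactSpace G] {c : V → G} {ℓ : G → V} (hc : IsLocalParam c ℓ)
    {W : Type*} [NormedAddCommGroup W] [InnerProductSpace ℝ W] {O : G → W} (hO : Continuous O)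
    (hiso : ∀ k g g', ‖O (k * g) - O (k * g')‖ = ‖O g - O g'‖) {D : V →ₗ[ℝ] W} {C : ℝ}
    (hD : ∀ᶠ m in 𝓝 0, ‖O (c m) - O 1 - D m‖ ≤ C * ‖m‖ ^ 2) :
    ∃ δ > 0, ∀ P g, ‖P - O 1‖ < δ → (∀ g', ‖P - O 1‖ ≤ ‖P - O g'‖) → ‖P - O g‖ ≤ ‖P - O 1‖ →
      O g = O 1 := by
  obtain ⟨κ, hκ, ρ₀, hρ₀, hparam⟩ := exists_param_norm_le hc hO hiso hD
  obtain ⟨ρ₁, hρ₁, hball⟩ := Metric.mem_nhds_iff.1 hD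
  set ρ := min ρ₀ ρ₁ / 2 with hρdef
  have hρ : 0 < ρ := by positivity
  have hρ0 : ρ < ρ₀ := by linarith [min_le_left ρ₀ ρ₁]
  have hρ1 : ρ < ρ₁ := by linarith [min_le_right ρ₀ ρ₁]
  -- by compactness, points of the orbit near `O 1` come from group elements near the stabilizer
  have hnear : ∃ δ₀ > 0, ∀ g, ‖O g - O 1‖ < δ₀ → ∃ m, ‖m‖ ≤ ρ ∧ O (c m) = O g := by
    by_contra! hcon
    have hn : ∀ n : ℕ, ∃ g, ‖O g - O 1‖ < 1 / ((n : ℝ) + 1) ∧ ∀ m, ‖m‖ ≤ ρ → O (c m) ≠ O g :=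
      fun n ↦ hcon _ Nat.one_div_pos_of_nat
    choose g hg hg' using hn
    obtain ⟨h, hh⟩ : ∃ h, MapClusterPt h atTop g := exists_clusterPt_of_compactSpace _
    have h1 : Tendsto (fun n ↦ ‖O (g n) - O 1‖) atTop (𝓝 0) :=
      squeeze_zero (fun _ ↦ norm_nonneg _) (fun n ↦ (hg n).le)
        tendsto_one_div_add_atTop_nhds_zero_nat
    have h2 : MapClusterPt ‖O h - O 1‖ atTop (fun n ↦ ‖O (g n) - O 1‖) :=
      hh.continuousAt_comp (f := fun g ↦ ‖O g - O 1‖) (by fun_prop)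
    have h3 : O h = O 1 := by
      have := eq_of_nhds_neBot (ClusterPt.mono h2 h1)
      rwa [norm_eq_zero, sub_eq_zero] at this
    have h4 : ∀ᶠ k in 𝓝 h, ‖ℓ (k * h⁻¹)‖ < ρ ∧ c (ℓ (k * h⁻¹)) = k * h⁻¹ := by
      have hcont : Tendsto (fun k : G ↦ k * h⁻¹) (𝓝 h) (𝓝 1) := by
        have : Continuous (fun k : G ↦ k * h⁻¹) := by fun_prop
        simpa using this.tendsto h
      have hℓ : ∀ᶠ k in 𝓝 (1 : G), ‖ℓ k‖ < ρ := by
        have : Tendsto (fun k ↦ ‖ℓ k‖) (𝓝 1) (𝓝 0) := by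
          simpa [hc.map_one] using hc.continuousAt_symm.tendsto.norm
        exact this.eventually_lt_const hρ
      exact hcont.eventually (hℓ.and hc.right_inv)
    obtain ⟨n, hn1, hn2⟩ := (hh.frequently h4).exists
    exact hg' n _ hn1.le (by rw [hn2, orbit_mul_inv_eq hiso h3])
  obtain ⟨δ₀, hδ₀, hnear⟩ := hnear
  refine ⟨min (δ₀ / 2) (κ ^ 2 / (2 * (|C| + 1))), by positivity, fun P g hP hmin hg ↦ ?_⟩
  obtain ⟨hP1, hP2⟩ := lt_min_iff.1 hP
  rw [lt_div_iff₀ (by positivity)] at hP2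
  have hgO : ‖O g - O 1‖ < δ₀ := by
    have : ‖O g - O 1‖ ≤ ‖P - O 1‖ + ‖P - O g‖ := by
      rw [norm_sub_rev P (O g), add_comm]; exact norm_sub_le_norm_sub_add_norm_sub _ _ _
    linarith
  obtain ⟨m, hmρ, hOm, hκm⟩ := hparam ρ hρ hρ0 g (hnear g hgO)
  have horth : inner ℝ (P - O 1) (D m) = 0 := by
    have hder : HasDerivAt (fun t : ℝ ↦ O (c (t • m))) (D m) 0 := by
      rw [hasDerivAt_iff_isLittleO]
      have hsq : (fun t : ℝ ↦ t ^ 2) =o[𝓝 0] fun t ↦ t - 0 := by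
        simpa using (Asymptotics.isLittleO_pow_pow (𝕜 := ℝ) one_lt_two)
      refine Asymptotics.IsBigO.trans_isLittleO ?_ hsq
      refine Asymptotics.IsBigO.of_bound (|C| * ‖m‖ ^ 2) ?_
      have ht : Tendsto (fun t : ℝ ↦ t • m) (𝓝 0) (𝓝 0) := by
        have : Continuous (fun t : ℝ ↦ t • m) := by fun_prop
        simpa using this.tendsto 0
      filter_upwards [ht.eventually hD] with t ht
      rw [map_smul] at ht
      simp only [zero_smul, hc.map_zero, sub_zero]
      refine ht.trans ?_
      rw [norm_smul, mul_pow, norm_pow]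
      calc C * (‖t‖ ^ 2 * ‖m‖ ^ 2) ≤ |C| * (‖t‖ ^ 2 * ‖m‖ ^ 2) := by
            gcongr; exact le_abs_self C
        _ = _ := by ring
    have hloc : IsLocalMin (fun t : ℝ ↦ ‖P - O (c (t • m))‖ ^ 2) 0 :=
      .of_forall fun t ↦ by
        simp only [zero_smul, hc.map_zero]
        gcongr
        exact hmin _
    have := hloc.hasDerivAt_eq_zero (hder.const_sub P).norm_sq
    simpa [hc.map_zero] using this
  have hT : ‖O (c m) - O 1 - D m‖ ≤ C * ‖m‖ ^ 2 :=
    hball (mem_ball_zero_iff.2 (hmρ.trans_lt hρ1))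
  rw [hOm] at hT
  have hinner : inner ℝ (P - O 1) (O g - O 1) ≤ ‖P - O 1‖ * (C * ‖m‖ ^ 2) := by
    have h1 : inner ℝ (P - O 1) (O g - O 1) = inner ℝ (P - O 1) (O g - O 1 - D m) := by
      rw [inner_sub_right _ _ (D m), horth, sub_zero]
    rw [h1]
    exact (real_inner_le_norm _ _).trans (by gcongr)
  have hexp : ‖P - O g‖ ^ 2 = ‖P - O 1‖ ^ 2 - 2 * inner ℝ (P - O 1) (O g - O 1)
      + ‖O g - O 1‖ ^ 2 := by
    rw [← norm_sub_sq_real]; congr 2; abel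
  have hgsq : ‖P - O g‖ ^ 2 ≤ ‖P - O 1‖ ^ 2 := by gcongr
  have hκsq : κ ^ 2 * ‖m‖ ^ 2 ≤ ‖O g - O 1‖ ^ 2 := by
    rw [← mul_pow]; gcongr
  have hm0 : ‖m‖ ^ 2 ≤ 0 := by
    by_contra! hpos
    have h1 : κ ^ 2 * ‖m‖ ^ 2 ≤ 2 * (‖P - O 1‖ * (C * ‖m‖ ^ 2)) := by linarith
    have h2 : ‖P - O 1‖ * (C * ‖m‖ ^ 2) ≤ ‖P - O 1‖ * ((|C| + 1) * ‖m‖ ^ 2) := by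
      gcongr; linarith [le_abs_self C]
    have h3 := mul_lt_mul_of_pos_right hP2 hpos
    nlinarith
  have hm : m = 0 := by
    have := pow_eq_zero_iff (two_ne_zero) |>.1 (le_antisymm hm0 (by positivity))
    exact norm_eq_zero.1 this
  rw [← hOm, hm, hc.map_zero]

section

variable {V : Type*} [NormedAddCommGroup V] [NormedSpace ℝ V]
  {G : Type*} [Group G] [TopologicalSpace G] [ChartedSpace V G] [LieGroup 𝓘(ℝ, V) ∞ G]

/-- The local form, near a point of `G × G`, of the uniform Taylor estimate below. -/
theorem exists_taylor_bound_nhds {b : G → ℝ} (hb : ContMDiff 𝓘(ℝ, V) 𝓘(ℝ, ℝ) ∞ b) (g₀ h₀ : G) :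
    ∃ C ε : ℝ, 0 < ε ∧ ∀ᶠ p in 𝓝 (g₀, h₀), ∃ L : V →ₗ[ℝ] ℝ, ∀ m, ‖m‖ < ε →
      |b (p.1 * oneParam V G m * p.2) - b (p.1 * p.2) - L m| ≤ C * ‖m‖ ^ 2 := by
  set e₁ := extChartAt 𝓘(ℝ, V) g₀
  set e₂ := extChartAt 𝓘(ℝ, V) h₀
  set f : (V × V) × V → ℝ := fun q ↦ b (e₁.symm q.1.1 * oneParam V G q.2 * e₂.symm q.1.2)
  have hf : ContDiffAt ℝ 2 f ((e₁ g₀, e₂ h₀), 0) := by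
    refine ContDiffAt.of_le (n := ∞) ?_ (by norm_cast)
    rw [← contMDiffAt_iff_contDiffAt]
    have s₁ : ContMDiffAt 𝓘(ℝ, V) 𝓘(ℝ, V) ∞ e₁.symm (e₁ g₀) :=
      (contMDiffOn_extChartAt_symm g₀).contMDiffAt (extChartAt_target_mem_nhds g₀)
    have s₂ : ContMDiffAt 𝓘(ℝ, V) 𝓘(ℝ, V) ∞ e₂.symm (e₂ h₀) :=
      (contMDiffOn_extChartAt_symm h₀).contMDiffAt (extChartAt_target_mem_nhds h₀)
    have h1 := ContMDiffAt.comp (((e₁ g₀, e₂ h₀), (0 : V)) : (V × V) × V) s₁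
      (f := fun q : (V × V) × V ↦ q.1.1)
      (contDiff_fst.comp contDiff_fst).contMDiff.contMDiffAt
    have h2 := ContMDiffAt.comp (((e₁ g₀, e₂ h₀), (0 : V)) : (V × V) × V) s₂
      (f := fun q : (V × V) × V ↦ q.1.2)
      (contDiff_snd.comp contDiff_fst).contMDiff.contMDiffAt
    have h3 := ContMDiffAt.comp (((e₁ g₀, e₂ h₀), (0 : V)) : (V × V) × V)
      (contMDiffAt_oneParam_zero (V := V) (G := G)) (f := fun q : (V × V) × V ↦ q.2)
      contDiff_snd.contMDiff.contMDiffAt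
    exact (hb.contMDiffAt (x := _)).comp _ ((h1.mul h3).mul h2)
  obtain ⟨C, ε, hε, hbound⟩ := hf.exists_taylor_bound
  refine ⟨C, ε, hε, ?_⟩
  have c₁ : ContinuousAt (fun p : G × G ↦ (e₁ p.1, e₂ p.2)) (g₀, h₀) :=
    ((continuousAt_extChartAt g₀).comp_of_eq continuousAt_fst rfl).prodMk
      ((continuousAt_extChartAt h₀).comp_of_eq continuousAt_snd rfl)
  have m₁ : ∀ᶠ p in 𝓝 (g₀, h₀), p.1 ∈ e₁.source :=
    (continuousAt_fst (p := (g₀, h₀))).eventually (extChartAt_source_mem_nhds g₀)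
  have m₂ : ∀ᶠ p in 𝓝 (g₀, h₀), p.2 ∈ e₂.source :=
    (continuousAt_snd (p := (g₀, h₀))).eventually (extChartAt_source_mem_nhds h₀)
  filter_upwards [c₁.eventually hbound, m₁, m₂] with p ⟨L, hL⟩ hp₁ hp₂
  refine ⟨L, fun m hm ↦ ?_⟩
  simpa [f, e₁.left_inv hp₁, e₂.left_inv hp₂, oneParam_zero] using hL m hm

/-- Second order Taylor estimate, at `m = 0`, for the function `m ↦ b (g * oneParam m * h)`, uniform
in `g` and `h`. -/
theorem exists_uniform_taylor_bound [FiniteDimensional ℝ V] [CompactSpace G] {b : G → ℝ}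
    (hb : ContMDiff 𝓘(ℝ, V) 𝓘(ℝ, ℝ) ∞ b) :
    ∃ (T : V →ₗ[ℝ] C(G × G, ℝ)) (C : ℝ), ∀ᶠ m in 𝓝 0, ∀ p : G × G,
      |b (p.1 * oneParam V G m * p.2) - b (p.1 * p.2) - T m p| ≤ C * ‖m‖ ^ 2 := by
  have : IsTopologicalGroup G := topologicalGroup_of_lieGroup 𝓘(ℝ, V) ∞
  have hpt : ∃ C ε : ℝ, 0 < ε ∧ ∀ p : G × G, ∃ L : V →ₗ[ℝ] ℝ, ∀ m, ‖m‖ < ε →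
      |b (p.1 * oneParam V G m * p.2) - b (p.1 * p.2) - L m| ≤ C * ‖m‖ ^ 2 := by
    choose C ε hε hU using fun p : G × G ↦ exists_taylor_bound_nhds hb p.1 p.2
    obtain ⟨t, ht⟩ := finite_cover_nhds hU
    rcases t.eq_empty_or_nonempty with rfl | hne
    · have : (1 : G × G) ∈ (univ : Set (G × G)) := mem_univ _
      simp [← ht] at this
    · obtain ⟨i, hi, hiC⟩ := t.exists_max_image C hne
      obtain ⟨j, hj, hjε⟩ := t.exists_min_image ε hne
      refine ⟨C i, ε j, hε j, fun p ↦ ?_⟩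
      have hp : p ∈ ⋃ x ∈ t, _ := ht.symm ▸ mem_univ p
      obtain ⟨x, hx, L, hL⟩ := mem_iUnion₂.1 hp
      refine ⟨L, fun m hm ↦ (hL m (hm.trans_le (hjε x hx))).trans ?_⟩
      gcongr
      exact hiC x hx
  obtain ⟨C, ε, hε, hpt⟩ := hpt
  choose L hL using hpt
  -- the linear terms are uniform limits of difference quotients, hence continuous in `p`
  have hcont : ∀ m, Continuous fun p ↦ L p m := by
    intro m
    set s : ℕ → ℝ := fun n ↦ 1 / ((n : ℝ) + 1) with hs
    have hs0 : Tendsto s atTop (𝓝 0) := tendsto_one_div_add_atTop_nhds_zero_nat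
    have hspos : ∀ n, 0 < s n := fun n ↦ Nat.one_div_pos_of_nat
    have hsm : Tendsto (fun n ↦ s n • m) atTop (𝓝 0) := by
      simpa using hs0.smul_const m
    have hsm' : ∀ᶠ n in atTop, ‖s n • m‖ < ε := by
      have := hsm.norm
      rw [norm_zero] at this
      exact this.eventually_lt_const hε
    have hunif : TendstoUniformly (fun n (p : G × G) ↦
        (s n)⁻¹ * (b (p.1 * oneParam V G (s n • m) * p.2) - b (p.1 * p.2))) (fun p ↦ L p m)
        atTop := by
      rw [Metric.tendstoUniformly_iff]
      intro η hη
      have h0 : Tendsto (fun n ↦ C * ‖m‖ ^ 2 * s n) atTop (𝓝 0) := by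
        simpa using hs0.const_mul (C * ‖m‖ ^ 2)
      filter_upwards [hsm', h0.eventually_lt_const hη] with n hn hlt p
      have h1 := hL p _ hn
      rw [dist_comm, Real.dist_eq]
      refine lt_of_le_of_lt ?_ hlt
      rw [map_smul, smul_eq_mul, norm_smul, Real.norm_eq_abs, abs_of_pos (hspos n)] at h1
      have h2 : (s n)⁻¹ * (b (p.1 * oneParam V G (s n • m) * p.2) - b (p.1 * p.2)) - L p m =
          (s n)⁻¹ * (b (p.1 * oneParam V G (s n • m) * p.2) - b (p.1 * p.2) - s n * L p m) := by
        have := (hspos n).ne'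
        field_simp
      rw [h2, abs_mul, abs_of_pos (inv_pos.2 (hspos n)), inv_mul_le_iff₀ (hspos n)]
      refine h1.trans_eq ?_
      ring
    have hbc : Continuous b := hb.continuous
    exact hunif.continuous (.of_forall fun n ↦ by fun_prop)
  refine ⟨{ toFun := fun m ↦ ⟨fun p ↦ L p m, hcont m⟩
            map_add' := fun m n ↦ by ext p; simp
            map_smul' := fun r m ↦ by ext p; simp }, C, ?_⟩
  filter_upwards [Metric.ball_mem_nhds (0 : V) hε] with m hm p
  exact hL p m (mem_ball_zero_iff.1 hm)

end

/-! ### Smooth functions cutting out a subgroup -/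

/-- The integral over a subgroup in the second variable, with respect to a given measure on the
subgroup, as a linear map between spaces of continuous functions. -/
noncomputable def avgSnd {G : Type*} [Group G] [TopologicalSpace G] [FirstCountableTopology G]
    [CompactSpace G] [T2Space G] (H : Subgroup G) [CompactSpace H] [MeasurableSpace H]
    [BorelSpace H] (η : Measure H) [IsFiniteMeasure η] : C(G × G, ℝ) →ₗ[ℝ] C(G, ℝ) where
  toFun F :=
    { toFun := fun g ↦ ∫ h : H, F (g, h) ∂η
      continuous_toFun := by
        have := continuous_parametric_integral_of_continuous (μ := η) (s := univ)
          (f := fun (g : G) (h : H) ↦ F (g, h)) (by fun_prop) isCompact_univ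
        simpa using this }
  map_add' F F' := by
    ext g
    exact integral_add (Continuous.integrable_of_hasCompactSupport (by fun_prop)
      (HasCompactSupport.of_compactSpace _)) (Continuous.integrable_of_hasCompactSupport
      (by fun_prop) (HasCompactSupport.of_compactSpace _))
  map_smul' r F := by
    ext g
    exact integral_const_mul r _

/-- A closed subgroup `H` of a compact Lie group is the zero set of a right `H`-invariant function
with a uniform second order Taylor estimate: average a smooth nonnegative function with zero set
`H`. -/
theorem exists_invariant_function {V : Type*} [NormedAddCommGroup V] [NormedSpace ℝ V]
    [FiniteDimensional ℝ V] {G : Type*} [Group G] [TopologicalSpace G] [ChartedSpace V G]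
    [LieGroup 𝓘(ℝ, V) ∞ G] [T2Space G] [CompactSpace G] {H : Subgroup G}
    (hH : IsClosed (H : Set G)) :
    ∃ u : C(G, ℝ), (∀ y, ∀ h ∈ H, u (y * h) = u y) ∧ (∀ y, u y = 0 ↔ y ∈ H) ∧
      ∃ (T : V →ₗ[ℝ] C(G, ℝ)) (C : ℝ), ∀ᶠ m in 𝓝 0, ∀ g,
        |u (g * oneParam V G m) - u g - T m g| ≤ C * ‖m‖ ^ 2 := by
  have : IsTopologicalGroup G := topologicalGroup_of_lieGroup 𝓘(ℝ, V) ∞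
  have : SecondCountableTopology G := ChartedSpace.secondCountable_of_sigmaCompact V G
  have : CompactSpace H := isCompact_iff_compactSpace.1 hH.isCompact
  obtain ⟨b, hbs, hb, hb0⟩ := hH.isOpen_compl.exists_contMDiff_support_eq 𝓘(ℝ, V) (n := ⊤)
  have hbz : ∀ y, b y = 0 ↔ y ∈ H := fun y ↦ by
    have : y ∈ Function.support b ↔ y ∈ (H : Set G)ᶜ := by rw [hbs]
    simpa [not_iff_not] using this
  obtain ⟨T, C, hT⟩ := exists_uniform_taylor_bound hb
  have hbc : Continuous b := hb.continuous
  let _ : MeasurableSpace H := borel H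
  have : BorelSpace H := ⟨rfl⟩
  set η : Measure H := Measure.haar
  have hint : ∀ f : H → ℝ, Continuous f → Integrable f η := fun f hf ↦
    hf.integrable_of_hasCompactSupport (HasCompactSupport.of_compactSpace _)
  set u : C(G, ℝ) := avgSnd H η ⟨fun p ↦ b (p.1 * p.2), by fun_prop⟩
  have hu : ∀ y, u y = ∫ h : H, b (y * h) ∂η := fun y ↦ rfl
  refine ⟨u, fun y h hh ↦ ?_, fun y ↦ ?_, avgSnd H η ∘ₗ T, C * η.real univ, ?_⟩
  · rw [hu, hu, ← integral_mul_left_eq_self (μ := η) (fun k : H ↦ b (y * k)) ⟨h, hh⟩]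
    simp [mul_assoc]
  · have hc : Continuous fun h : H ↦ b (y * h) := by fun_prop
    rw [hu, integral_eq_zero_iff_of_nonneg (fun h ↦ hb0 _) (hint _ hc)]
    constructor
    · intro h
      have h1 : b (y * (1 : H)) = 0 := congr_fun ((hc.ae_eq_iff_eq η continuous_const).1 h) 1
      simpa using (hbz _).1 h1
    · intro hy
      refine .of_forall fun h ↦ (hbz _).2 (H.mul_mem hy h.2)
  · filter_upwards [hT] with m hm g
    have e : u (g * oneParam V G m) - u g - (avgSnd H η ∘ₗ T) m g =
        ∫ h : H, (b (g * oneParam V G m * h) - b (g * h) - T m (g, h)) ∂η := by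
      rw [integral_sub (hint _ (by fun_prop)) (hint _ (by fun_prop)),
        integral_sub (hint _ (by fun_prop)) (hint _ (by fun_prop))]
      rfl
    rw [e, ← Real.norm_eq_abs]
    refine (norm_integral_le_of_norm_le_const (C := C * ‖m‖ ^ 2)
      (.of_forall fun h : H ↦ ?_)).trans_eq (by ring)
    exact hm (g, h)

/-! ### Slices -/

/-- A continuous function on an orbit of a compact group, given in terms of the group, extends to
the whole space. -/
theorem exists_extension_of_orbit {G : Type*} [Group G] [TopologicalSpace G] [CompactSpace G]
    {Y : Type*} [TopologicalSpace Y] [T2Space Y] [CompactSpace Y] [MulAction G Y]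
    [ContinuousSMul G Y] {x₀ : Y} (u : C(G, ℝ))
    (hu : ∀ y, ∀ h ∈ MulAction.stabilizer G x₀, u (y * h) = u y) :
    ∃ ψ : C(Y, ℝ), ∀ g : G, ψ (g • x₀) = u g := by
  set π : G → MulAction.orbit G x₀ := fun g ↦ ⟨g • x₀, MulAction.mem_orbit x₀ g⟩ with hπ
  have hπc : Continuous π := by rw [hπ]; fun_prop
  have hπs : Function.Surjective π := by
    rintro ⟨_, g, rfl⟩
    exact ⟨g, rfl⟩
  have hq : IsQuotientMap (⟨π, hπc⟩ : C(G, MulAction.orbit G x₀)) :=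
    hπc.isClosedMap.isQuotientMap hπc hπs
  have hfac : Function.FactorsThrough u (⟨π, hπc⟩ : C(G, MulAction.orbit G x₀)) := by
    intro g k hgk
    have h1 : g • x₀ = k • x₀ := congrArg Subtype.val hgk
    have h2 : g⁻¹ * k ∈ MulAction.stabilizer G x₀ := by
      rw [MulAction.mem_stabilizer_iff, mul_smul, ← h1, inv_smul_smul]
    simpa using (hu g _ h2).symm
  have horb : IsClosed (MulAction.orbit G x₀) := by
    have : IsCompact (range fun g : G ↦ g • x₀) := isCompact_range (by fun_prop)
    exact this.isClosed
  obtain ⟨ψ, hψ⟩ := (hq.lift u hfac).exists_restrict_eq horb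
  refine ⟨ψ, fun g ↦ ?_⟩
  have h1 := DFunLike.congr_fun hψ (π g)
  have h2 := DFunLike.congr_fun (hq.lift_comp u hfac) g
  exact h1.trans h2

/-- A compact Lie group acting on a compact Hausdorff space: there is a function `F` whose minimum
points on an orbit close to the orbit of `x₀` are moved to each other only by elements of the
stabilizer of `x₀`.
Here `F` is the distance from `φ x` to `φ x₀` in `L²(G)`, where `φ x` is the function
`g ↦ ψ (g⁻¹ • x)` and `ψ` extends the function on the orbit of `x₀` that was built above. -/
theorem exists_slice_function {V : Type*} [NormedAddCommGroup V] [NormedSpace ℝ V]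
    [FiniteDimensional ℝ V] {G : Type*} [Group G] [TopologicalSpace G] [ChartedSpace V G]
    [LieGroup 𝓘(ℝ, V) ∞ G] [T2Space G] [CompactSpace G]
    {Y : Type*} [TopologicalSpace Y] [T2Space Y] [CompactSpace Y] [MulAction G Y]
    [ContinuousSMul G Y] (x₀ : Y) :
    ∃ F : Y → ℝ, Continuous F ∧ F x₀ = 0 ∧ ∃ δ > 0, ∀ x (g : G), F x < δ →
      (∀ g' : G, F x ≤ F (g' • x)) → F (g • x) ≤ F x → g ∈ MulAction.stabilizer G x₀ := by
  have : IsTopologicalGroup G := topologicalGroup_of_lieGroup 𝓘(ℝ, V) ∞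
  obtain ⟨u, huH, hu0, T, C, hT⟩ := exists_invariant_function (V := V) (G := G)
    (isClosed_stabilizer (G := G) x₀)
  obtain ⟨ψ, hψ⟩ := exists_extension_of_orbit u huH
  let _ : MeasurableSpace G := borel G
  have : BorelSpace G := ⟨rfl⟩
  have : SecondCountableTopology G := ChartedSpace.secondCountable_of_sigmaCompact V G
  set μ : Measure G := Measure.haar
  set J : C(G, ℝ) →L[ℝ] Lp ℝ 2 μ := ContinuousMap.toLp 2 μ ℝ with hJ
  have hJnorm : ∀ f : C(G, ℝ), ‖J f‖ ^ 2 = ∫ g, f g ^ 2 ∂μ := by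
    intro f
    rw [← real_inner_self_eq_norm_sq, hJ, ContinuousMap.inner_toLp]
    simp [pow_two]
  have hJtrans : ∀ (f f' : C(G, ℝ)) (k : G), (∀ g, f' g = f (k * g)) → ‖J f'‖ = ‖J f‖ := by
    intro f f' k hff'
    rw [← sq_eq_sq₀ (norm_nonneg _) (norm_nonneg _), hJnorm, hJnorm]
    simp_rw [hff']
    exact integral_mul_left_eq_self (μ := μ) (fun g ↦ f g ^ 2) k
  -- the translates of `ψ` along the orbits
  set Φ : C(Y, C(G, ℝ)) := ContinuousMap.curry ⟨fun p : Y × G ↦ ψ (p.2⁻¹ • p.1), by fun_prop⟩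
  have hΦ : ∀ x g, Φ x g = ψ (g⁻¹ • x) := fun _ _ ↦ rfl
  have hinv : ∀ (k : G) (x y : Y), ‖J (Φ (k • x)) - J (Φ (k • y))‖ = ‖J (Φ x) - J (Φ y)‖ := by
    intro k x y
    rw [← map_sub J, ← map_sub J]
    refine hJtrans _ _ k⁻¹ fun g ↦ ?_
    simp [hΦ, mul_smul]
  have hstab : ∀ g : G, J (Φ (g • x₀)) = J (Φ ((1 : G) • x₀)) → g ∈ MulAction.stabilizer G x₀ := by
    intro g hg
    have h1 : Φ (g • x₀) = Φ ((1 : G) • x₀) := ContinuousMap.toLp_injective μ hg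
    have h2 := DFunLike.congr_fun h1 1
    simp only [hΦ, inv_one, one_smul] at h2
    rw [← hu0 g, ← hψ, h2, ← one_smul G x₀, hψ]
    exact (hu0 1).2 (one_mem _)
  -- precomposition with the inversion
  set R : C(G, ℝ) →ₗ[ℝ] C(G, ℝ) :=
    { toFun := fun f ↦ f.comp ⟨fun g ↦ g⁻¹, by fun_prop⟩
      map_add' := fun _ _ ↦ rfl
      map_smul' := fun _ _ ↦ rfl }
  have hR : ∀ f g, R f g = f g⁻¹ := fun _ _ ↦ rfl
  have hTaylor : ∀ᶠ m in 𝓝 (0 : V), ‖J (Φ (oneParam V G m • x₀)) - J (Φ ((1 : G) • x₀)) -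
      ((J : C(G, ℝ) →ₗ[ℝ] Lp ℝ 2 μ) ∘ₗ R ∘ₗ T) m‖ ≤ ‖J‖ * |C| * ‖m‖ ^ 2 := by
    filter_upwards [hT] with m hm
    have e : J (Φ (oneParam V G m • x₀)) - J (Φ ((1 : G) • x₀)) -
        ((J : C(G, ℝ) →ₗ[ℝ] Lp ℝ 2 μ) ∘ₗ R ∘ₗ T) m =
        J (Φ (oneParam V G m • x₀) - Φ ((1 : G) • x₀) - R (T m)) := by
      rw [map_sub J, map_sub J]; rfl
    rw [e, mul_assoc]
    refine (J.le_opNorm _).trans ?_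
    gcongr
    refine (ContinuousMap.norm_le _ (by positivity)).2 fun g ↦ ?_
    have h1 := hm g⁻¹
    simp only [ContinuousMap.sub_apply, hΦ, hR, one_smul, smul_smul, hψ, Real.norm_eq_abs]
    refine h1.trans ?_
    gcongr
    exact le_abs_self C
  obtain ⟨δ, hδ, hreach⟩ := orbit_positive_reach (isLocalParam_oneParam (V := V) (G := G))
    (O := fun g : G ↦ J (Φ (g • x₀))) (by fun_prop)
    (fun k g g' ↦ by simpa [mul_smul] using hinv k (g • x₀) (g' • x₀)) hTaylor
  refine ⟨fun x ↦ ‖J (Φ x) - J (Φ x₀)‖, by fun_prop, by simp, δ, hδ, fun x g hx hmin hg ↦ ?_⟩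
  have hmove : ∀ k : G, ‖J (Φ (k • x)) - J (Φ x₀)‖ = ‖J (Φ x) - J (Φ (k⁻¹ • x₀))‖ := fun k ↦ by
    simpa using hinv k x (k⁻¹ • x₀)
  have key := hreach (J (Φ x)) g⁻¹ (by simpa using hx)
    (fun g' ↦ by simpa [hmove] using hmin g'⁻¹) (by simpa [hmove] using hg)
  simpa using hstab _ key

section

variable {G : Type*} [Group G] {X : Type*} [MulAction G X] {Z : Type*}

/-- The part over `K` of the pullback of the quotient map `X → X / G` along `h`. -/
abbrev PullbackOn (h : Z → Quotient (MulAction.orbitRel G X)) (K : Set Z) : Type _ :=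
  {p : Z × X // p.1 ∈ K ∧ Quotient.mk (MulAction.orbitRel G X) p.2 = h p.1}

namespace PullbackOn

variable (h : Z → Quotient (MulAction.orbitRel G X)) (K : Set Z)

instance : MulAction G (PullbackOn h K) where
  smul g p := ⟨(p.1.1, g • p.1.2), p.2.1, by
    rw [← p.2.2]; exact Quotient.sound (MulAction.orbitRel_apply.2 ⟨g, rfl⟩)⟩
  one_smul _ := Subtype.ext (Prod.ext rfl (one_smul G _))
  mul_smul g k _ := Subtype.ext (Prod.ext rfl (mul_smul g k _))

variable {h K}

theorem smul_snd (g : G) (p : PullbackOn h K) : (g • p).1.2 = g • p.1.2 := rfl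

theorem stabilizer_eq (p : PullbackOn h K) :
    MulAction.stabilizer G p = MulAction.stabilizer G p.1.2 := by
  ext g
  rw [MulAction.mem_stabilizer_iff, MulAction.mem_stabilizer_iff]
  exact ⟨fun e ↦ by rw [← smul_snd, e], fun e ↦ Subtype.ext (Prod.ext rfl e)⟩

theorem exists_smul_eq {p p' : PullbackOn h K} (e : p.1.1 = p'.1.1) : ∃ g : G, p = g • p' := by
  obtain ⟨g, hg⟩ := exists_smul_eq_of_mk_eq (p.2.2.trans ((congrArg h e).trans p'.2.2.symm))
  exact ⟨g, Subtype.ext (Prod.ext e hg)⟩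

variable [TopologicalSpace X] [TopologicalSpace Z]

theorem continuous_fst : Continuous fun p : PullbackOn h K ↦ p.1.1 :=
  _root_.continuous_fst.comp continuous_subtype_val

theorem continuous_snd : Continuous fun p : PullbackOn h K ↦ p.1.2 :=
  _root_.continuous_snd.comp continuous_subtype_val

instance [TopologicalSpace G] [ContinuousSMul G X] : ContinuousSMul G (PullbackOn h K) where
  continuous_smul := by
    refine Continuous.subtype_mk (Continuous.prodMk ?_ ?_) _
    · exact continuous_fst.comp _root_.continuous_snd
    · exact _root_.continuous_fst.smul (continuous_snd.comp _root_.continuous_snd)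

end PullbackOn

/-- The quotient map by an action of a compact group is proper. -/
theorem isProperMap_quotientMk [TopologicalSpace X] [TopologicalSpace G] [IsTopologicalGroup G]
    [CompactSpace G] [ContinuousSMul G X] : IsProperMap (Quotient.mk (MulAction.orbitRel G X)) := by
  refine isProperMap_iff_isClosedMap_and_compact_fibers.2
    ⟨continuous_quotient_mk', MulAction.isClosedMap_quotient, fun y ↦ ?_⟩
  obtain ⟨x, rfl⟩ := Quotient.exists_rep y
  have e : Quotient.mk (MulAction.orbitRel G X) ⁻¹' {Quotient.mk _ x} =
      range fun g : G ↦ g • x := by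
    ext z
    simp only [mem_preimage, mem_singleton_iff, mem_range]
    exact Quotient.eq.trans MulAction.orbitRel_apply
  rw [e]
  exact isCompact_range (by fun_prop)

theorem PullbackOn.compactSpace [TopologicalSpace X] [TopologicalSpace Z] [TopologicalSpace G]
    [IsTopologicalGroup G] [CompactSpace G] [ContinuousSMul G X]
    {h : Z → Quotient (MulAction.orbitRel G X)} (hh : Continuous h) {K : Set Z}
    (hK : IsCompact K) : CompactSpace (PullbackOn h K) := by
  have hp : IsProperMap (Prod.map (id : Z → Z) (Quotient.mk (MulAction.orbitRel G X))) :=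
    (Homeomorph.refl Z).isProperMap.prodMap isProperMap_quotientMk
  have hc : IsCompact ((fun z ↦ (z, h z)) '' K) := hK.image (by fun_prop)
  have e : {p : Z × X | p.1 ∈ K ∧ Quotient.mk (MulAction.orbitRel G X) p.2 = h p.1} =
      Prod.map (id : Z → Z) (Quotient.mk (MulAction.orbitRel G X)) ⁻¹'
        ((fun z ↦ (z, h z)) '' K) := by
    ext p
    constructor
    · rintro ⟨h1, h2⟩
      exact ⟨p.1, h1, Prod.ext rfl h2.symm⟩
    · rintro ⟨z, hz, e⟩
      obtain ⟨rfl, e2⟩ := Prod.ext_iff.1 e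
      exact ⟨hz, e2.symm⟩
  have hcomp := hp.isCompact_preimage hc
  rw [← e] at hcomp
  exact isCompact_iff_compactSpace.1 hcomp

end

/-- A map into the orbit space of an action with one orbit type lifts locally, over compact sets. -/
theorem exists_isOpen_liftsOn {V : Type*} [NormedAddCommGroup V] [NormedSpace ℝ V]
    [FiniteDimensional ℝ V] {G : Type*} [Group G] [TopologicalSpace G] [ChartedSpace V G]
    [LieGroup 𝓘(ℝ, V) ∞ G] [T2Space G] [CompactSpace G]
    {X : Type*} [TopologicalSpace X] [T2Space X] [MulAction G X] [ContinuousSMul G X]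
    {H : Subgroup G}
    (hH : ∀ x : X, ∃ g : G, MulAction.stabilizer G x = H.map (MulAut.conj g).toMonoidHom)
    {Z : Type*} [TopologicalSpace Z] [T2Space Z]
    {h : Z → Quotient (MulAction.orbitRel G X)} (hh : Continuous h) {K : Set Z}
    (hK : IsCompact K) {z₀ : Z} (hz₀ : z₀ ∈ K) :
    ∃ U : Set Z, IsOpen U ∧ z₀ ∈ U ∧ LiftsOn H h (U ∩ K) := by
  have : IsTopologicalGroup G := topologicalGroup_of_lieGroup 𝓘(ℝ, V) ∞
  have : CompactSpace (PullbackOn h K) := PullbackOn.compactSpace hh hK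
  obtain ⟨x₀, hx₀, hstab⟩ : ∃ x : X, Quotient.mk (MulAction.orbitRel G X) x = h z₀ ∧
      MulAction.stabilizer G x = H := by
    obtain ⟨x, hx⟩ := Quotient.exists_rep (h z₀)
    obtain ⟨g, hg⟩ := hH x
    refine ⟨g⁻¹ • x, ?_, ?_⟩
    · rw [← hx]; exact Quotient.sound (MulAction.orbitRel_apply.2 ⟨g⁻¹, rfl⟩)
    · rw [MulAction.stabilizer_smul_eq_stabilizer_map_conj, hg, Subgroup.map_map]
      convert H.map_id
      ext z
      simp [mul_assoc]
  set p₀ : PullbackOn h K := ⟨(z₀, x₀), hz₀, hx₀⟩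
  have hp₀ : MulAction.stabilizer G p₀ = H := (PullbackOn.stabilizer_eq p₀).trans hstab
  obtain ⟨F, hF, hF0, δ, hδ, hslice⟩ := exists_slice_function (V := V) (G := G) p₀
  rw [hp₀] at hslice
  -- the slice: the points of an orbit where `F` is least
  set S : Set (PullbackOn h K) := {p | (∀ g : G, F p ≤ F (g • p)) ∧ F p ≤ δ / 2} with hS
  have hSc : IsClosed S := by
    rw [hS, ofPred_and, ofPred_forall]
    exact (isClosed_iInter fun g ↦ isClosed_le hF (by fun_prop)).inter
      (isClosed_le hF continuous_const)
  have : CompactSpace S := isCompact_iff_compactSpace.1 hSc.isCompact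
  have hSH : ∀ p ∈ S, ∀ g : G, F (g • p) ≤ F p → g ∈ H := fun p hp g hg ↦
    hslice p g (by linarith [hp.2]) hp.1 hg
  have hSstab : ∀ p ∈ S, MulAction.stabilizer G p = H := by
    intro p hp
    have hle : MulAction.stabilizer G p ≤ MulAction.stabilizer G p₀ := fun g hg ↦ by
      rw [hp₀]
      exact hSH p hp g (by rw [MulAction.mem_stabilizer_iff.1 hg])
    rw [PullbackOn.stabilizer_eq, PullbackOn.stabilizer_eq] at hle
    rw [PullbackOn.stabilizer_eq, stabilizer_eq_of_le hH hle, ← PullbackOn.stabilizer_eq, hp₀]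
  have hemb : IsClosedEmbedding fun p : S ↦ p.1.1.1 := by
    refine (PullbackOn.continuous_fst.comp continuous_subtype_val).isClosedEmbedding ?_
    rintro ⟨p, hp⟩ ⟨p', hp'⟩ e
    obtain ⟨g, rfl⟩ := PullbackOn.exists_smul_eq e
    have hg : g ∈ MulAction.stabilizer G p' := by
      rw [hSstab p' hp']
      refine hSH p' hp' g ?_
      simpa using hp.1 g⁻¹
    exact Subtype.ext (MulAction.mem_stabilizer_iff.1 hg)
  set B : Set (PullbackOn h K) := {p | ∀ g : G, δ / 2 ≤ F (g • p)} with hB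
  have hBc : IsClosed B := by
    rw [hB, ofPred_forall]
    exact isClosed_iInter fun g ↦ isClosed_le continuous_const (by fun_prop)
  have hex : ∀ z ∈ ((fun p : PullbackOn h K ↦ p.1.1) '' B)ᶜ ∩ K, ∃ p : S, p.1.1.1 = z := by
    rintro z ⟨hz, hzK⟩
    obtain ⟨x, hx⟩ := Quotient.exists_rep (h z)
    set p : PullbackOn h K := ⟨(z, x), hzK, hx⟩
    have hpB : p ∉ B := fun hpB ↦ hz ⟨p, hpB, rfl⟩
    simp only [hB, mem_ofPred_eq, not_forall, not_le] at hpB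
    obtain ⟨g, hg⟩ := hpB
    obtain ⟨k, -, hk⟩ := isCompact_univ.exists_isMinOn (univ_nonempty (α := G))
      (f := fun g : G ↦ F (g • p)) (by fun_prop)
    have hk' : ∀ g : G, F (k • p) ≤ F (g • p) := fun g ↦ hk (mem_univ g)
    exact ⟨⟨k • p, fun g' ↦ by simpa [smul_smul] using hk' (g' * k), (hk' g).trans hg.le⟩, rfl⟩
  choose j hj using fun z : ↥(((fun p : PullbackOn h K ↦ p.1.1) '' B)ᶜ ∩ K) ↦ hex z z.2
  classical
  refine ⟨((fun p : PullbackOn h K ↦ p.1.1) '' B)ᶜ, ?_, ?_, fun z ↦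
    if hz : z ∈ ((fun p : PullbackOn h K ↦ p.1.1) '' B)ᶜ ∩ K then (j ⟨z, hz⟩).1.1.2 else x₀,
    ?_, ?_⟩
  · exact (hBc.isCompact.image PullbackOn.continuous_fst).isClosed.isOpen_compl
  · rintro ⟨p, hpB, hp⟩
    obtain ⟨g, hg⟩ := PullbackOn.exists_smul_eq (p := p₀) (p' := p) hp.symm
    have := hpB g
    rw [← hg, hF0] at this
    linarith
  · rw [continuousOn_iff_continuous_domRestrict]
    have hjc : Continuous j := by
      rw [hemb.isEmbedding.continuous_iff]
      exact continuous_subtype_val.congr fun z ↦ (hj z).symm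
    refine (PullbackOn.continuous_snd.comp (continuous_subtype_val.comp hjc)).congr fun z ↦ ?_
    simp only [domRestrict_apply, Function.comp_apply]
    rw [dif_pos z.2]
  · intro z hz
    simp only [dif_pos hz]
    refine ⟨?_, ?_⟩
    · rw [(j ⟨z, hz⟩).1.2.2, hj]
    · rw [← PullbackOn.stabilizer_eq, hSstab _ (j ⟨z, hz⟩).2]

/-! ### Lifting homotopies -/

theorem theoremA9 {V : Type*} [NormedAddCommGroup V] [NormedSpace ℝ V] [FiniteDimensional ℝ V]
    {G : Type*} [Group G] [TopologicalSpace G] [ChartedSpace V G] [LieGroup 𝓘(ℝ, V) ∞ G]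
    [T2Space G] [CompactSpace G]
    {X : Type*} [TopologicalSpace X] [T2Space X] [CompactlyGeneratedSpace X]
    [MulAction G X] [ContinuousSMul G X]
    (H : Subgroup G)
    (hH : ∀ x : X, ∃ g : G,
      MulAction.stabilizer G x = H.map (MulAut.conj g).toMonoidHom) :
    IsSerreFibration
      (Quotient.mk (MulAction.orbitRel G X) : X → Quotient (MulAction.orbitRel G X)) := by
  refine ⟨continuous_quotient_mk', fun n f h hfh ↦ ?_⟩
  -- the homotopy, extended to `ℝⁿ⁺¹`, with the time as coordinate `0`
  set h' : (Fin (n + 1) → ℝ) → Quotient (MulAction.orbitRel G X) := fun z ↦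
    h (fun i ↦ projIcc 0 1 zero_le_one (z i.succ), projIcc 0 1 zero_le_one (z 0)) with hh'
  have hh'c : Continuous h' := by
    refine h.continuous.comp (Continuous.prodMk (continuous_pi fun i ↦ ?_) ?_)
    · exact continuous_projIcc.comp (continuous_apply i.succ)
    · exact continuous_projIcc.comp (continuous_apply 0)
  obtain ⟨κ, hκ, hκ'⟩ := liftsOn_Icc_of_locally (a := 0) (b := 1)
    fun z hz ↦ exists_isOpen_liftsOn (V := V) hH hh'c isCompact_Icc hz
  set ι : (Fin n → I) × I → (Fin (n + 1) → ℝ) := fun p ↦ Fin.cons (p.2 : ℝ) fun i ↦ (p.1 i : ℝ)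
  have hι : Continuous ι := by
    refine continuous_pi fun i ↦ ?_
    refine Fin.cases ?_ (fun i ↦ ?_) i
    · exact continuous_subtype_val.comp continuous_snd
    · exact continuous_subtype_val.comp ((continuous_apply i).comp continuous_fst)
  have hιI : ∀ p, ι p ∈ Icc (0 : Fin (n + 1) → ℝ) 1 := by
    refine fun p ↦ ⟨fun i ↦ ?_, fun i ↦ ?_⟩
    · exact Fin.cases p.2.2.1 (fun i ↦ (p.1 i).2.1) i
    · exact Fin.cases p.2.2.2 (fun i ↦ (p.1 i).2.2) i
  have hιh : ∀ p, h' (ι p) = h p := fun p ↦ by simp [hh', ι]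
  have hγ : Continuous fun p ↦ κ (ι p) := hκ.comp_continuous hι hιI
  have hmk : ∀ p, Quotient.mk (MulAction.orbitRel G X) (κ (ι p)) = h p := fun p ↦
    (hκ' _ (hιI p)).1.trans (hιh p)
  have hst : ∀ p, MulAction.stabilizer G (κ (ι p)) = H := fun p ↦ (hκ' _ (hιI p)).2
  have hg : ∀ a, ∃ g : G, f a = g • κ (ι (a, 0)) := fun a ↦
    exists_smul_eq_of_mk_eq ((hfh a).symm.trans (hmk (a, 0)).symm)
  choose g hg using hg
  -- move the lift `κ` by the group elements that move its start to `f`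
  have hk : Continuous fun p : (Fin n → I) × I ↦ g p.1 • κ (ι p) := by
    rw [← continuousOn_univ]
    refine continuousOn_smul_of_eq_smul (Z := (Fin n → I) × I) (α := fun p ↦ κ (ι (p.1, 0)))
      (β := fun p ↦ f p.1)
      (n := fun p ↦ g p.1) ?_ ?_ ?_ (fun p _ ↦ hg p.1)
      (fun p _ ↦ ((hst _).trans (hst _).symm).le)
    · exact (hγ.comp (by fun_prop : Continuous fun p : (Fin n → I) × I ↦
        (p.1, (0 : I)))).continuousOn
    · exact (f.continuous.comp continuous_fst).continuousOn
    · exact hγ.continuousOn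
  refine ⟨⟨_, hk⟩, fun a ↦ (hg a).symm, fun p ↦ ?_⟩
  rw [← hmk p]
  exact Quotient.sound (MulAction.orbitRel_apply.2 ⟨g p.1, rfl⟩)
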